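/- Let $\mathcal F$ be the fermionic Fock space with basis the semi-infinite wedges $|S\rangle=e_{\ell_1}\wedge e_{\ell_2}\wedge\cdots$, where $S=\{\ell_1>\ell_2>\cdots\}\subset\mathbf Z$ contains all but finitely many negative integers and only finitely many non-negative ones (equivalently $|\lambda;N\rangle$ with $\ell_i=\lambda_i-i+N$, $\lambda$ a partition, $N\in\mathbf Z$), with vacuum $|0\rangle=e_{-1}\wedge e_{-2}\wedge\cdots$. Let $\psi_i=e_i\wedge$, $\psi^*_i=i_{\tilde e^i}$, $\psi(z)=\sum_{i\in\mathbf Z}\psi_iz^i$, $\psi^*(w)=\sum_{j\in\mathbf Z}\psi^*_jw^{-j-1}$, and $\hat\gamma_+(\mathbf t)=\exp\big(\sum_{k\ge1}t_kJ_k\big)$ with $J_k=\sum_{j}{:}\psi_j\psi^*_{j+k}{:}$. Let $g=(g_{ij})_{i,j\in\mathbf Z}$ be a complex lower triangular matrix ($g_{ij}=0$ for $j>i$) with Clifford representative $\hat g=\exp\big(\sum_{i,j}A_{ij}{:}\psi_i\psi^*_j{:}\big)$, where $A$ is lower triangular and $g=e^A$; $\hat g$ acts on formal infinite linear combinations of the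 $|S\rangle$. Put $$\tau_g(\mathbf t)=\langle0|\hat\gamma_+(\mathbf t)\hat g|0\rangle=\sum_S\langle0|\hat\gamma_+(\mathbf t)|S\rangle\langle S|\hat g|0\rangle,\qquad [w^{-1}]-[z^{-1}]=\Big(\tfrac1k(w^{-k}-z^{-k})\Big)_{k\ge1},$$ $$\tilde K_2^g(z,w)=\begin{cases}\ \ \langle0|\psi(z)\psi^*(w)\hat g|0\rangle=\sum_{i,j}z^iw^{-j-1}\langle0|\psi_i\psi^*_j\hat g|0\rangle,&|z|>|w|,\\ -\langle0|\psi^*(w)\psi(z)\hat g|0\rangle=-\sum_{i,j}z^iw^{-j-1}\langle0|\psi^*_j\psi_i\hat g|0\rangle,&|z|<|w|.\end{cases}$$ Then $$\tilde K^g_2(z,w)=\frac{\tau_g([w^{-1}]-[z^{-1}])}{z-w}$$ in each of the following senses. 1. For nonzero complex numbers $z,w$ with $|z|\ne|w|$, the double series for $\tilde K^g_2(z,w)$ converges absolutely if and only if the series for $\tau_g([w^{-1}]-[z^{-1}])$ does, and in that case the identity holds. 2. As formal series in $z^{\pm1},w^{\pm1}$, without any convergence assumption: $\langle0|\psi(z)\psi^*(w)\hat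 g|0\rangle$ (respectively $-\langle0|\psi^*(w)\psi(z)\hat g|0\rangle$) is the product of the formal series $\tau_g([w^{-1}]-[z^{-1}])$ in $z^{-1},w^{-1}$ with the expansion $\sum_{k\ge0}w^kz^{-k-1}$ (respectively $-\sum_{k\ge0}z^kw^{-k-1}$) of $\frac1{z-w}$. 3. As an identity of linear functionals on $\mathcal F$: for all nonzero complex $z,w$ with $|z|\neq|w|$, $\langle0|\psi(z)\psi^*(w)$ if $|z|>|w|$, respectively $-\langle0|\psi^*(w)\psi(z)$ if $|z|<|w|$, equals $\frac1{z-w}\langle0|\hat\gamma_+([w^{-1}]-[z^{-1}])$; on every basis vector $|S\rangle$ the double series on the left converges absolutely. -/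

import Mathlib

open scoped Nat

noncomputable section

namespace FermiFock

/-! ### Fermionic Fock space -/

/-- A Maya diagram: a set `S` of integers (the occupied sites) with finitely many occupied
sites `≥ 0` and finitely many empty sites `< 0`.  Listing the elements of `S` in decreasing order
`ℓ₁ > ℓ₂ > ⋯` identifies it with the wedge `e_{ℓ₁} ∧ e_{ℓ₂} ∧ ⋯`, i.e. with the basis vector
`|λ; N⟩`, `ℓ_i = λ_i - i + N`, for a unique partition `λ` and a unique charge `N`. -/
@[ext] structure Maya where
  carrier : Set ℤ
  finite_nonneg : {k : ℤ | k ∈ carrier ∧ 0 ≤ k}.Finite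
  finite_neg : {k : ℤ | k ∉ carrier ∧ k < 0}.Finite

namespace Maya

/-- The Dirac sea `e_{-1} ∧ e_{-2} ∧ ⋯`. -/
def vac : Maya where
  carrier := {k | k < 0}
  finite_nonneg := by
    convert Set.finite_empty (α := ℤ)
    ext k; simp
  finite_neg := by
    convert Set.finite_empty (α := ℤ)
    ext k; simp

/-- Fill the site `i`. -/
def fill (S : Maya) (i : ℤ) : Maya where
  carrier := insert i S.carrier
  finite_nonneg := (S.finite_nonneg.insert i).subset (by
    rintro k ⟨h | h, h'⟩
    · exact Or.inl h
    · exact Or.inr ⟨h, h'⟩)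
  finite_neg := S.finite_neg.subset (by
    rintro k ⟨h, h'⟩
    exact ⟨fun hk => h (Or.inr hk), h'⟩)

/-- Empty the site `i`. -/
def clear (S : Maya) (i : ℤ) : Maya where
  carrier := S.carrier \ {i}
  finite_nonneg := S.finite_nonneg.subset (by
    rintro k ⟨h, h'⟩
    exact ⟨h.1, h'⟩)
  finite_neg := (S.finite_neg.insert i).subset (by
    rintro k ⟨h, h'⟩
    by_cases hk : k = i
    · exact Or.inl hk
    · exact Or.inr ⟨fun hS => h ⟨hS, hk⟩, h'⟩)

/-- The sign `(-1)^{#{k ∈ S : k > i}}` picked up by moving `e_i` from the front of the wedge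
to its place. -/
def sgn (S : Maya) (i : ℤ) : ℤ := (-1) ^ ({k : ℤ | k ∈ S.carrier ∧ i < k}.ncard)

end Maya

/-- The fermionic Fock space over a coefficient ring `R`: finite linear combinations of the
basis vectors. -/
abbrev Fock (R : Type*) [CommRing R] := Maya →₀ R

/-- The completed Fock space: arbitrary formal (possibly infinite) linear combinations, with
complex coefficients, of the basis vectors. -/
abbrev CFock := Maya → ℂ

section Operators

variable (R : Type*) [CommRing R]

/-- The basis vector `|S⟩`. -/
def ket (S : Maya) : Fock R := Finsupp.single S 1

open Classical in
/-- `ψ_i = e_i ∧`. -/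
def psi (i : ℤ) : Module.End R (Fock R) :=
  Finsupp.linearCombination R fun S =>
    if i ∈ S.carrier then 0 else (S.sgn i : R) • ket R (S.fill i)

open Classical in
/-- `ψ*_i`, interior multiplication by the dual basis vector `ẽ^i`. -/
def psiStar (i : ℤ) : Module.End R (Fock R) :=
  Finsupp.linearCombination R fun S =>
    if i ∈ S.carrier then (S.sgn i : R) • ket R (S.clear i) else 0

/-- The normal ordered product `:ψ_i ψ*_j:`. The vacuum is annihilated by `ψ_i` for `i < 0`
and by `ψ*_j` for `j ≥ 0`. -/
def normalPair (i j : ℤ) : Module.End R (Fock R) :=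
  if i < 0 then -(psiStar R j * psi R i) else psi R i * psiStar R j

/-- The matrix element `⟨S| O |S'⟩`. -/
def matEl {R : Type*} [CommRing R] (O : Module.End R (Fock R)) (S S' : Maya) : R :=
  (O (ket R S')) S

/-- The current `J_n = ∑_j :ψ_j ψ*_{j+n}:`. On a basis vector only finitely many terms of the sum
are nonzero. -/
def current (n : ℤ) : Module.End R (Fock R) :=
  Finsupp.linearCombination R fun S => ∑ᶠ j : ℤ, normalPair R j (j + n) (ket R S)

variable {R} [Algebra ℚ R]

/-- `∑_{k ≥ 1} t_k J_k`; the entry `t 0` is not used. On a basis vector only finitely many terms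
of the sum are nonzero. -/
def flow (t : ℕ → R) : Module.End R (Fock R) :=
  Finsupp.linearCombination R fun S => ∑ᶠ k : ℕ, t (k + 1) • current R ((k : ℤ) + 1) (ket R S)

/-- `γ̂₊(t) = exp (∑_{k ≥ 1} t_k J_k)`. As `J_k`, `k ≥ 1`, lowers the energy by `k`, only finitely
many terms of the exponential series are nonzero on a basis vector. -/
def gammaPlus (t : ℕ → R) : Module.End R (Fock R) :=
  Finsupp.linearCombination R fun S => ∑ᶠ n : ℕ, ((n ! : ℚ)⁻¹) • ((flow t ^ n) (ket R S))

end Operators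

/-! ### Lower triangular group elements and their Clifford representatives -/

/-- `g_{ij} = 0` if `j > i`. -/
def IsLowerTriangular (g : ℤ → ℤ → ℂ) : Prop := ∀ i j, i < j → g i j = 0

/-- Powers of a doubly infinite matrix (the sums are finite for triangular matrices). -/
def matPow (A : ℤ → ℤ → ℂ) : ℕ → ℤ → ℤ → ℂ
  | 0 => fun i j => if i = j then 1 else 0
  | n + 1 => fun i j => ∑ᶠ k : ℤ, A i k * matPow A n k j

/-- The matrix element `⟨S| ∑_{i,j} A_{ij} :ψ_i ψ*_j: |S'⟩`. -/
def quadMatrix (A : ℤ → ℤ → ℂ) (S S' : Maya) : ℂ :=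
  ∑ᶠ p : ℤ × ℤ, A p.1 p.2 * matEl (normalPair ℂ p.1 p.2) S S'

/-- The action of `∑_{i,j} A_{ij} :ψ_i ψ*_j:` on the completed Fock space. For lower triangular `A`
the sums are finite. -/
def quadOp (A : ℤ → ℤ → ℂ) (v : CFock) : CFock :=
  fun S => ∑ᶠ S' : Maya, quadMatrix A S S' * v S'

/-- `exp (∑_{i,j} A_{ij} :ψ_i ψ*_j:)` on the completed Fock space, `A` lower triangular; the series
converges coefficientwise, see `summable_cliffordExp`. -/
def cliffordExp (A : ℤ → ℤ → ℂ) (v : CFock) : CFock :=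
  fun S => ∑' n : ℕ, ((n ! : ℂ)⁻¹) * ((quadOp A)^[n] v) S

/-- `G` is a Clifford representative `ĝ` of `g`: for some lower triangular `A` one has
`g = e^A` (entrywise convergent series of matrix powers) and
`G = exp (∑_{i,j} A_{ij} :ψ_i ψ*_j:)`. -/
def IsCliffordRep (g : ℤ → ℤ → ℂ) (G : CFock → CFock) : Prop :=
  ∃ A : ℤ → ℤ → ℂ, IsLowerTriangular A ∧
    (∀ i j, HasSum (fun n : ℕ => ((n ! : ℂ)⁻¹) * matPow A n i j) (g i j)) ∧
    G = cliffordExp A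

/-! The series that defines `cliffordExp` converges. -/

/-- The diagrams that have all sites `< m` occupied and all sites `> M` empty. -/
def box (m M : ℤ) : Set Maya :=
  {S | (∀ k ∈ S.carrier, k ≤ M) ∧ ∀ k, k < m → k ∈ S.carrier}

theorem box_finite (m M : ℤ) : (box m M).Finite := by
  apply Set.Finite.of_finite_image (f := fun S : Maya => S.carrier ∩ Set.Icc m M)
  · apply (Set.finite_Icc m M).finite_subsets.subset
    rintro _ ⟨S, -, rfl⟩
    exact Set.inter_subset_right
  · intro S hS T hT h
    ext k
    have hk : k ∈ S.carrier ∩ Set.Icc m M ↔ k ∈ T.carrier ∩ Set.Icc m M := by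
      have h' : S.carrier ∩ Set.Icc m M = T.carrier ∩ Set.Icc m M := h
      rw [h']
    have h1 := hS.1 k
    have h2 := hS.2 k
    have h3 := hT.1 k
    have h4 := hT.2 k
    simp only [Set.mem_inter_iff, Set.mem_Icc] at hk
    by_cases h5 : k < m
    · simp [h2 h5, h4 h5]
    · by_cases h6 : k ≤ M
      · have : m ≤ k ∧ k ≤ M := ⟨by omega, h6⟩
        tauto
      · tauto

theorem exists_mem_box (S : Maya) : ∃ m M : ℤ, m ≤ 0 ∧ 0 ≤ M ∧ S ∈ box m M := by
  obtain ⟨M, hM⟩ := S.finite_nonneg.bddAbove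
  obtain ⟨m, hm⟩ := S.finite_neg.bddBelow
  refine ⟨min m 0, max M 0, min_le_right _ _, le_max_right _ _, fun k hk => ?_, fun k hk => ?_⟩
  · by_cases h : 0 ≤ k
    · exact (hM ⟨hk, h⟩).trans (le_max_left _ _)
    · exact (by omega : k ≤ 0).trans (le_max_right _ _)
  · by_contra hS
    have h0 : k < 0 := lt_of_lt_of_le hk (min_le_right _ _)
    have := hm ⟨hS, h0⟩
    have := lt_of_lt_of_le hk (min_le_left _ _)
    omega

open Classical in
theorem psi_ket (i : ℤ) (S : Maya) : psi ℂ i (ket ℂ S) =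
    if i ∈ S.carrier then 0 else (S.sgn i : ℂ) • ket ℂ (S.fill i) := by
  simp [psi, ket]

open Classical in
theorem psiStar_ket (i : ℤ) (S : Maya) : psiStar ℂ i (ket ℂ S) =
    if i ∈ S.carrier then (S.sgn i : ℂ) • ket ℂ (S.clear i) else 0 := by
  simp [psiStar, ket]

theorem norm_sgn (S : Maya) (i : ℤ) : ‖(S.sgn i : ℂ)‖ = 1 := by
  simp [Maya.sgn]

open Classical in
theorem norm_ket_le (S S' : Maya) : ‖(ket ℂ S) S'‖ ≤ 1 := by
  unfold ket
  rw [Finsupp.single_apply]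
  split_ifs <;> simp

open Classical in
theorem eq_of_ket_ne {S S' : Maya} (h : (ket ℂ S) S' ≠ 0) : S' = S := by
  unfold ket at h
  rw [Finsupp.single_apply] at h
  by_contra hne
  exact h (if_neg fun h => hne h.symm)

theorem norm_matEl_le (i j : ℤ) (S S' : Maya) : ‖matEl (normalPair ℂ i j) S S'‖ ≤ 1 := by
  unfold matEl normalPair
  split_ifs with hi
  · simp only [LinearMap.neg_apply, Module.End.mul_apply, psi_ket]
    split_ifs
    · simp
    · rw [map_smul, psiStar_ket]
      split_ifs
      · simp only [Finsupp.neg_apply, Finsupp.smul_apply, norm_neg, norm_smul, norm_sgn, one_mul]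
        exact norm_ket_le _ _
      · simp
  · simp only [Module.End.mul_apply, psiStar_ket]
    split_ifs
    · rw [map_smul, psi_ket]
      split_ifs
      · simp
      · simp only [Finsupp.smul_apply, norm_smul, norm_sgn, one_mul]
        exact norm_ket_le _ _
    · simp

theorem mem_box_of_matEl_ne {m M i j : ℤ} (hm : m ≤ 0) (hM : 0 ≤ M) (hij : j ≤ i) {S S' : Maya}
    (hS : S ∈ box m M) (h : matEl (normalPair ℂ i j) S S' ≠ 0) :
    S' ∈ box m M ∧ m ≤ j ∧ i ≤ M := by
  unfold matEl normalPair at h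
  obtain ⟨hS1, hS2⟩ := hS
  split_ifs at h with hi
  · simp only [LinearMap.neg_apply, Module.End.mul_apply, psi_ket] at h
    split_ifs at h with h1
    · simp at h
    · rw [map_smul, psiStar_ket] at h
      split_ifs at h with h2
      · have h3 : S = (S'.fill i).clear j := by
          apply eq_of_ket_ne
          intro h0
          simp [h0] at h
        have h4 : ∀ k, k ∈ S.carrier ↔ (k = i ∨ k ∈ S'.carrier) ∧ k ≠ j := by
          intro k
          rw [h3]
          exact Iff.rfl
        have hj : m ≤ j := by
          by_contra hlt
          exact ((h4 j).1 (hS2 j (by omega))).2 rfl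
        refine ⟨⟨fun k hk => ?_, fun k hk => ?_⟩, hj, by omega⟩
        · by_cases hkj : k = j
          · omega
          · exact hS1 k ((h4 k).2 ⟨Or.inr hk, hkj⟩)
        · rcases ((h4 k).1 (hS2 k hk)).1 with h5 | h5
          · omega
          · exact h5
      · simp at h
  · simp only [Module.End.mul_apply, psiStar_ket] at h
    split_ifs at h with h1
    · rw [map_smul, psi_ket] at h
      split_ifs at h with h2
      · simp at h
      · have h3 : S = (S'.clear j).fill i := by
          apply eq_of_ket_ne
          intro h0
          simp [h0] at h
        have h4 : ∀ k, k ∈ S.carrier ↔ k = i ∨ (k ∈ S'.carrier ∧ k ≠ j) := by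
          intro k
          rw [h3]
          exact Iff.rfl
        have hi' : i ≤ M := hS1 i ((h4 i).2 (Or.inl rfl))
        have hj : m ≤ j := by
          by_contra hlt
          rcases (h4 j).1 (hS2 j (by omega)) with h5 | h5
          · omega
          · exact h5.2 rfl
        refine ⟨⟨fun k hk => ?_, fun k hk => ?_⟩, hj, hi'⟩
        · by_cases hkj : k = j
          · omega
          · exact hS1 k ((h4 k).2 (Or.inr ⟨hk, hkj⟩))
        · rcases (h4 k).1 (hS2 k hk) with h5 | h5
          · omega
          · exact h5.1
    · simp at h

theorem mem_box_of_quadMatrix_ne {A : ℤ → ℤ → ℂ} (hA : IsLowerTriangular A) {m M : ℤ}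
    (hm : m ≤ 0) (hM : 0 ≤ M) {S S' : Maya} (hS : S ∈ box m M) (h : quadMatrix A S S' ≠ 0) :
    S' ∈ box m M := by
  have hex : ∃ p : ℤ × ℤ, A p.1 p.2 * matEl (normalPair ℂ p.1 p.2) S S' ≠ 0 := by
    by_contra! hall
    exact h (by simp [quadMatrix, hall])
  obtain ⟨p, hp⟩ := hex
  have h1 : p.2 ≤ p.1 := by
    by_contra hlt
    exact hp (by simp [hA p.1 p.2 (by omega)])
  exact (mem_box_of_matEl_ne hm hM h1 hS (right_ne_zero_of_mul hp)).1

theorem norm_quadMatrix_le {A : ℤ → ℤ → ℂ} (hA : IsLowerTriangular A) {m M : ℤ}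
    (hm : m ≤ 0) (hM : 0 ≤ M) {S : Maya} (hS : S ∈ box m M) (S' : Maya) :
    ‖quadMatrix A S S'‖ ≤ ∑ p ∈ Finset.Icc m M ×ˢ Finset.Icc m M, ‖A p.1 p.2‖ := by
  unfold quadMatrix
  rw [finsum_eq_sum_of_support_subset (s := Finset.Icc m M ×ˢ Finset.Icc m M)]
  · refine (norm_sum_le _ _).trans (Finset.sum_le_sum fun p _ => ?_)
    rw [norm_mul]
    exact mul_le_of_le_one_right (norm_nonneg _) (norm_matEl_le _ _ _ _)
  · intro p hp
    have h1 : p.2 ≤ p.1 := by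
      by_contra hlt
      exact hp (by simp [hA p.1 p.2 (by omega)])
    have h2 := (mem_box_of_matEl_ne hm hM h1 hS (right_ne_zero_of_mul hp)).2
    simp only [Finset.coe_product, Finset.coe_Icc, Set.mem_prod, Set.mem_Icc]
    omega

/-- For lower triangular `A` the series defining `cliffordExp A` converges coefficientwise. -/
theorem summable_cliffordExp {A : ℤ → ℤ → ℂ} (hA : IsLowerTriangular A) (v : CFock) (S : Maya) :
    Summable fun n : ℕ => ((n ! : ℂ)⁻¹) * ((quadOp A)^[n] v) S := by
  obtain ⟨m, M, hm, hM, hS⟩ := exists_mem_box S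
  set D := (box_finite m M).toFinset with hD
  set C := ∑ p ∈ Finset.Icc m M ×ˢ Finset.Icc m M, ‖A p.1 p.2‖ with hC
  have hC0 : 0 ≤ C := Finset.sum_nonneg fun _ _ => norm_nonneg _
  set B := ∑ T ∈ D, ‖v T‖ with hB
  have key : ∀ n : ℕ, ∀ T ∈ box m M, ‖((quadOp A)^[n] v) T‖ ≤ (D.card * C) ^ n * B := by
    intro n
    induction n with
    | zero =>
      intro T hT
      simpa using Finset.single_le_sum (f := fun T => ‖v T‖) (fun _ _ => norm_nonneg _)
        ((box_finite m M).mem_toFinset.2 hT)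
    | succ n ih =>
      intro T hT
      rw [Function.iterate_succ_apply']
      set u := (quadOp A)^[n] v with hu
      unfold quadOp
      rw [finsum_eq_sum_of_support_subset (s := D)]
      · have h1 : ∀ T' ∈ D, ‖quadMatrix A T T' * u T'‖ ≤ C * ((D.card * C) ^ n * B) := by
          intro T' hT'
          rw [norm_mul]
          exact mul_le_mul (norm_quadMatrix_le hA hm hM hT T')
            (ih T' ((box_finite m M).mem_toFinset.1 hT')) (norm_nonneg _) hC0
        refine (norm_sum_le _ _).trans ((Finset.sum_le_card_nsmul D _ _ h1).trans (le_of_eq ?_))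
        rw [nsmul_eq_mul]
        ring
      · intro T' hT'
        exact (box_finite m M).mem_toFinset.2
          (mem_box_of_quadMatrix_ne hA hm hM hT (left_ne_zero_of_mul hT'))
  refine Summable.of_norm_bounded
    (g := fun n : ℕ => ((D.card * C) ^ n / (n ! : ℝ)) * B)
    ((Real.summable_pow_div_factorial _).mul_right B) fun n => ?_
  rw [norm_mul, norm_inv, Complex.norm_natCast]
  calc ((n ! : ℝ))⁻¹ * ‖((quadOp A)^[n] v) S‖
      ≤ ((n ! : ℝ))⁻¹ * ((D.card * C) ^ n * B) :=
        mul_le_mul_of_nonneg_left (key n S hS) (by positivity)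
    _ = _ := by ring

/-! ### Vacuum expectation values -/

/-- The vector `ĝ|0⟩` of the completed Fock space. -/
def orbitVec (G : CFock → CFock) : CFock := G fun S => ket ℂ Maya.vac S

/-- `⟨0| O ĝ |0⟩ = ∑_S ⟨0| O |S⟩ ⟨S| ĝ |0⟩` for a finite product `O` of `ψ_i`'s and `ψ*_j`'s; only
finitely many terms are nonzero. -/
def vev (O : Module.End ℂ (Fock ℂ)) (G : CFock → CFock) : ℂ :=
  ∑ᶠ S : Maya, matEl O Maya.vac S * orbitVec G S

/-- `[w⁻¹] - [z⁻¹]`, the sequence with `k`-th entry `(w^{-k} - z^{-k}) / k`, `k ≥ 1`. -/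
def miwa (z w : ℂ) : ℕ → ℂ := fun k => (w⁻¹ ^ k - z⁻¹ ^ k) / k

/-- The terms `⟨0| γ̂₊(t) |S⟩ ⟨S| ĝ |0⟩` of the series for `τ_g(t)`. -/
def tauTerm (G : CFock → CFock) (t : ℕ → ℂ) (S : Maya) : ℂ :=
  matEl (gammaPlus t) Maya.vac S * orbitVec G S

/-- `τ_g(t) = ⟨0| γ̂₊(t) ĝ |0⟩`. -/
def tau (G : CFock → CFock) (t : ℕ → ℂ) : ℂ := ∑' S : Maya, tauTerm G t S

/-- The product `ψ_i ψ*_j` if `|z| > |w|`, and `-ψ*_j ψ_i` otherwise (used for `|z| < |w|`). -/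
def orderedPair (z w : ℂ) (i j : ℤ) : Module.End ℂ (Fock ℂ) :=
  if ‖w‖ < ‖z‖ then psi ℂ i * psiStar ℂ j else -(psiStar ℂ j * psi ℂ i)

/-- The terms of the double series for the pair correlator, where `ψ(z) = ∑_i ψ_i z^i` and
`ψ*(w) = ∑_j ψ*_j w^{-j-1}`. -/
def pairTerm (G : CFock → CFock) (z w : ℂ) (p : ℤ × ℤ) : ℂ :=
  z ^ p.1 * w ^ (-p.2 - 1) * vev (orderedPair z w p.1 p.2) G

/-- The pair correlator: `⟨0| ψ(z) ψ*(w) ĝ |0⟩` if `|z| > |w|` and `-⟨0| ψ*(w) ψ(z) ĝ |0⟩` if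
`|z| < |w|`. -/
def pairCorrelator (G : CFock → CFock) (z w : ℂ) : ℂ := ∑' p : ℤ × ℤ, pairTerm G z w p

/-! ### Formal series -/

/-- Laurent polynomials in `z, w`; the pair `(a, b)` stands for `z^a w^b`. -/
abbrev LaurentZW := AddMonoidAlgebra ℂ (ℤ × ℤ)

/-- `[w⁻¹] - [z⁻¹]` as a sequence of Laurent polynomials in `z, w`. -/
def formalMiwa : ℕ → LaurentZW := fun k =>
  ((k : ℚ)⁻¹) • (AddMonoidAlgebra.single (0, -(k : ℤ)) 1 - AddMonoidAlgebra.single (-(k : ℤ), 0) 1)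

/-- `τ_g([w⁻¹] - [z⁻¹])` as a formal series in `z⁻¹, w⁻¹`: its coefficient of `z^a w^b`. Only
finitely many terms are nonzero, as `⟨0| γ̂₊(t) |S⟩` is homogeneous of the degree (weight) of the
partition of `S`. -/
def formalTau (G : CFock → CFock) (a b : ℤ) : ℂ :=
  ∑ᶠ S : Maya, (matEl (gammaPlus formalMiwa) Maya.vac S).coeff (a, b) * orbitVec G S

/-- The product of two formal series in `z^{±1}, w^{±1}`, given by their coefficients of `z^a w^b`
(used only where the sums are finite). -/
def seriesMul (f h : ℤ → ℤ → ℂ) (a b : ℤ) : ℂ :=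
  ∑ᶠ p : ℤ × ℤ, f p.1 p.2 * h (a - p.1) (b - p.2)

/-- The expansion `∑_{k ≥ 0} z^{-k-1} w^k` of `1/(z - w)` for `|z| > |w|`. -/
def cauchyOuter (a b : ℤ) : ℂ := if a < 0 ∧ b = -a - 1 then 1 else 0

/-- The expansion `-∑_{k ≥ 0} z^k w^{-k-1}` of `1/(z - w)` for `|z| < |w|`. -/
def cauchyInner (a b : ℤ) : ℂ := if 0 ≤ a ∧ b = -a - 1 then -1 else 0

/-- The formal series `⟨0| ψ(z) ψ*(w) ĝ |0⟩`: its coefficient of `z^a w^b`. -/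
def formalPairOuter (G : CFock → CFock) (a b : ℤ) : ℂ :=
  vev (psi ℂ a * psiStar ℂ (-b - 1)) G

/-- The formal series `-⟨0| ψ*(w) ψ(z) ĝ |0⟩`: its coefficient of `z^a w^b`. -/
def formalPairInner (G : CFock → CFock) (a b : ℤ) : ℂ :=
  vev (-(psiStar ℂ (-b - 1) * psi ℂ a)) G

end FermiFock

end

/-!
The vector `ĝ|0⟩` may be replaced by an arbitrary element of the completed Fock space: everything
follows from an identity of covectors, which says that both sides are supported on the vacuum and on
the hooks, i.e. the diagrams with one hole `i < 0` and one particle `j ≥ 0`.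

For the pair `ψ_i ψ*_j` this is immediate (`matEl_psi_mul_psiStar_of_ne`): if `i ≠ j`, then
`⟨0|ψ_i ψ*_j` is `±` the dual basis vector of `hook i j`, or zero, and the diagonal terms add up to
the expansion of `⟨0| / (z - w)`.

The matrix elements of `γ̂₊(t)` for `t_k = (a^k - b^k) / k` are computed over any commutative
`ℚ`-algebra, so that numbers and Laurent polynomials are treated at once. Let `F = ∑ t_k J_k`,
`D = ∑ k t_k J_k = ∑ (a^k - b^k) J_k` and let `E` be the energy. From `[E, J_k] = -k J_k` and
`[J_k, J_l] = 0` one gets the Euler relation `u E = u D` for `u = ⟨0| exp F` (`vacGamma_energyOp`).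
With the shift `T ψ_i = ψ_{i-1}` one has `[D, ψ_i] = (aT / (1 - aT) - bT / (1 - bT)) ψ_i`, and hence
`Q_i = (1 - aT) / (1 - bT) ψ_i` satisfies `[E - D, Q_i] = (i + 1/2) Q_i`
(`euler_commutator_dressed`). Therefore `(u Q_i)(E + i + 1/2) = (u Q_i) D`, and as `D` lowers the
energy and `E ≥ 0`, induction on the energy yields `u Q_i = 0` for `i ≥ 0` (`apply_geomSum`). This
says `u ψ_i = (a - b) a^i ∑_{m < 0} b^{-m-1} u ψ_m` for `i ≥ 0`. Together with the analogous
relation for `ψ*` it determines `u` on basis vectors: one finds `u = 1` on the vacuum,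
`u = ± (a - b) a^j b^{-i-1}` on `hook i j` (`vacGamma_hook`) and `u = 0` otherwise
(`vacGamma_of_ne`).

For `a = w⁻¹`, `b = z⁻¹` the value on `hook i j` is `± (z - w) z^i w^{-j-1}`. So the double series
and the series for `τ_g` have the same terms up to the factor `z - w` and a convergent geometric
series. For formal series the hook formula says that `τ_g([w⁻¹] - [z⁻¹])` is `z - w` times the pair
series (`formalTau_eq_outer`), and dividing by `z - w` amounts to a telescoping sum.
-/

noncomputable section

namespace FermiFock

/-! ### Maya diagrams: signs and energy -/

namespace Maya

@[simp] theorem mem_fill {S : Maya} {i k : ℤ} : k ∈ (S.fill i).carrier ↔ k = i ∨ k ∈ S.carrier :=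
  Iff.rfl

@[simp] theorem mem_clear {S : Maya} {i k : ℤ} :
    k ∈ (S.clear i).carrier ↔ k ∈ S.carrier ∧ k ≠ i :=
  Iff.rfl

@[simp] theorem mem_vac {k : ℤ} : k ∈ vac.carrier ↔ k < 0 :=
  Iff.rfl

theorem fill_clear {S : Maya} {i : ℤ} (h : i ∈ S.carrier) : (S.clear i).fill i = S := by
  ext k
  simp only [mem_fill, mem_clear]
  by_cases hk : k = i <;> simp_all

theorem clear_fill {S : Maya} {i : ℤ} (h : i ∉ S.carrier) : (S.fill i).clear i = S := by
  ext k
  simp only [mem_fill, mem_clear]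
  by_cases hk : k = i <;> simp_all

theorem fill_fill_comm (S : Maya) (i j : ℤ) : (S.fill i).fill j = (S.fill j).fill i := by
  ext k
  simp only [mem_fill]
  tauto

theorem clear_clear_comm (S : Maya) (i j : ℤ) : (S.clear i).clear j = (S.clear j).clear i := by
  ext k
  simp only [mem_clear]
  tauto

theorem fill_clear_comm (S : Maya) {i j : ℤ} (h : i ≠ j) :
    (S.fill i).clear j = (S.clear j).fill i := by
  ext k
  simp only [mem_clear, mem_fill]
  grind

theorem finite_above (S : Maya) (i : ℤ) : {k : ℤ | k ∈ S.carrier ∧ i < k}.Finite := by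
  refine (S.finite_nonneg.union (Set.finite_Icc i 0)).subset ?_
  rintro k ⟨h, h'⟩
  by_cases hk : 0 ≤ k
  · exact Or.inl ⟨h, hk⟩
  · exact Or.inr ⟨h'.le, by omega⟩

theorem sgn_fill {S : Maya} {j : ℤ} (hj : j ∉ S.carrier) (i : ℤ) :
    (S.fill j).sgn i = if i < j then -S.sgn i else S.sgn i := by
  unfold sgn
  split_ifs with h
  · have : {k : ℤ | k ∈ (S.fill j).carrier ∧ i < k} =
        insert j {k : ℤ | k ∈ S.carrier ∧ i < k} := by
      ext k
      simp only [mem_fill, Set.mem_ofPred_eq, Set.mem_insert_iff]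
      grind
    rw [this, Set.ncard_insert_of_notMem (fun h => hj h.1) (S.finite_above i), pow_succ]
    ring
  · have : {k : ℤ | k ∈ (S.fill j).carrier ∧ i < k} = {k : ℤ | k ∈ S.carrier ∧ i < k} := by
      ext k
      simp only [mem_fill, Set.mem_ofPred_eq]
      grind
    rw [this]

theorem sgn_clear {S : Maya} {j : ℤ} (hj : j ∈ S.carrier) (i : ℤ) :
    (S.clear j).sgn i = if i < j then -S.sgn i else S.sgn i := by
  have h := sgn_fill (S := S.clear j) (j := j) (by simp) i
  rw [fill_clear hj] at h
  rw [h]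
  split_ifs <;> simp

theorem sgn_mul_self (S : Maya) (i : ℤ) : S.sgn i * S.sgn i = 1 := by
  unfold sgn
  rw [← mul_pow]
  simp

theorem intCast_sgn_mul_self {R : Type*} [CommRing R] (S : Maya) (i : ℤ) :
    (S.sgn i : R) * (S.sgn i : R) = 1 := by
  rw [← Int.cast_mul, sgn_mul_self, Int.cast_one]

/-- Every diagram arises from the vacuum by finitely many fillings and clearings. -/
theorem induction_fill_clear {P : Maya → Prop} (hvac : P vac)
    (hfill : ∀ S i, i ∉ S.carrier → P S → P (S.fill i))
    (hclear : ∀ S i, i ∈ S.carrier → P S → P (S.clear i)) (S : Maya) : P S := by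
  -- holes first, particles second
  have h1 : ∀ H : Finset ℤ, (∀ k ∈ H, k < 0) →
      ∀ T : Maya, (∀ k, k ∈ T.carrier ↔ k < 0 ∧ k ∉ H) → P T := by
    intro H
    induction H using Finset.induction_on with
    | empty =>
      intro _ T hT
      have : T = vac := by ext k; simp [hT]
      exact this ▸ hvac
    | insert a H ha ih =>
      intro hH T hT
      have ha0 : a < 0 := hH a (by simp)
      have haT : a ∉ T.carrier := by simp [hT]
      rw [← clear_fill haT]
      refine hclear _ _ (by simp) (ih (fun k hk => hH k (by simp [hk])) _ fun k => ?_)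
      simp only [mem_fill, hT, Finset.mem_insert]
      by_cases hk : k = a <;> simp_all
  have h2 : ∀ Q : Finset ℤ, (∀ k ∈ Q, 0 ≤ k) →
      ∀ T : Maya, (∀ k, 0 ≤ k → (k ∈ T.carrier ↔ k ∈ Q)) → P T := by
    intro Q
    induction Q using Finset.induction_on with
    | empty =>
      intro _ T hT
      refine h1 T.finite_neg.toFinset (by simp) T fun k => ?_
      simp only [Set.Finite.mem_toFinset, Set.mem_ofPred_eq]
      by_cases hk : k < 0
      · simp [hk]
      · have := hT k (by omega)
        simp_all
    | insert a Q ha ih =>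
      intro hQ T hT
      have ha0 : 0 ≤ a := hQ a (by simp)
      have haT : a ∈ T.carrier := by simp [hT a ha0]
      rw [← fill_clear haT]
      refine hfill _ _ (by simp) (ih (fun k hk => hQ k (by simp [hk])) _ fun k hk => ?_)
      simp only [mem_clear, hT k hk, Finset.mem_insert]
      by_cases hk : k = a <;> simp_all
  refine h2 S.finite_nonneg.toFinset (by simp) S fun k hk => ?_
  simp [hk]

open Classical in
/-- The contribution of the site `k` to twice the energy. -/
def energyTerm (S : Maya) (k : ℤ) : ℤ :=
  ((if k ∈ S.carrier then 1 else 0) - (if k < 0 then 1 else 0)) * (2 * k + 1)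

/-- Twice the energy: a particle at `k ≥ 0` has energy `k + 1/2`, a hole at `k < 0` has energy
`-k - 1/2`. The factor two keeps the values integral. -/
def energy (S : Maya) : ℤ := ∑ᶠ k : ℤ, S.energyTerm k

theorem energyTerm_nonneg (S : Maya) (k : ℤ) : 0 ≤ S.energyTerm k := by
  unfold energyTerm
  split_ifs <;> omega

theorem finite_support_energyTerm (S : Maya) : (Function.support S.energyTerm).Finite := by
  refine (S.finite_nonneg.union S.finite_neg).subset fun k hk => ?_
  simp only [energyTerm, Function.mem_support] at hk
  simp only [Set.mem_union, Set.mem_ofPred_eq]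
  by_cases h1 : k ∈ S.carrier <;> by_cases h2 : k < 0 <;> simp_all

theorem energy_nonneg (S : Maya) : 0 ≤ S.energy :=
  finsum_nonneg S.energyTerm_nonneg

theorem energy_vac : vac.energy = 0 := by
  unfold energy
  rw [← finsum_zero (α := ℤ)]
  congr 1
  ext k
  simp [energyTerm]

theorem energy_fill {S : Maya} {i : ℤ} (hi : i ∉ S.carrier) :
    (S.fill i).energy = S.energy + (2 * i + 1) := by
  have h : (S.fill i).energyTerm = fun k => S.energyTerm k + if k = i then 2 * i + 1 else 0 := by
    ext k
    by_cases hk : k = i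
    · subst hk
      have h1 : k ∈ (S.fill k).carrier := Or.inl rfl
      simp only [energyTerm, h1, hi, if_true, if_false]
      split_ifs <;> ring
    · have h1 : k ∈ (S.fill i).carrier ↔ k ∈ S.carrier := by simp [hk]
      by_cases h2 : k ∈ S.carrier <;> simp [energyTerm, h1.2, mt h1.1, h2, hk]
  unfold energy
  rw [h, finsum_add_distrib S.finite_support_energyTerm]
  · congr 1
    rw [finsum_eq_single _ i fun k hk => if_neg hk, if_pos rfl]
  · refine (Set.finite_singleton i).subset fun k hk => ?_
    by_contra h
    exact hk (if_neg h)

theorem energy_clear {S : Maya} {i : ℤ} (hi : i ∈ S.carrier) :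
    (S.clear i).energy = S.energy - (2 * i + 1) := by
  have h := energy_fill (S := S.clear i) (i := i) (by simp)
  rw [fill_clear hi] at h
  omega

end Maya

/-! ### Canonical anticommutation relations -/

section CAR

variable {R : Type*} [CommRing R]

open Classical in
theorem psi_apply_ket (i : ℤ) (S : Maya) : psi R i (ket R S) =
    if i ∈ S.carrier then 0 else (S.sgn i : R) • ket R (S.fill i) := by
  simp [psi, ket]

open Classical in
theorem psiStar_apply_ket (i : ℤ) (S : Maya) : psiStar R i (ket R S) =
    if i ∈ S.carrier then (S.sgn i : R) • ket R (S.clear i) else 0 := by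
  simp [psiStar, ket]

theorem end_ext_ket {A B : Module.End R (Fock R)} (h : ∀ S, A (ket R S) = B (ket R S)) :
    A = B := by
  refine Finsupp.lhom_ext' fun S => LinearMap.ext_ring ?_
  exact h S

theorem psi_mul_psi (i j : ℤ) : psi R i * psi R j = -(psi R j * psi R i) := by
  classical
  refine end_ext_ket fun S => ?_
  simp only [Module.End.mul_apply, LinearMap.neg_apply, psi_apply_ket]
  by_cases hi : i ∈ S.carrier <;> by_cases hj : j ∈ S.carrier
  · simp [hi, hj]
  · simp [hi, hj, psi_apply_ket]
  · simp [hi, hj, psi_apply_ket]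
  · by_cases hij : i = j
    · subst hij
      simp [hi, psi_apply_ket]
    · have hji : ¬ j = i := fun h => hij h.symm
      simp only [hi, hj, if_false, map_smul, psi_apply_ket, Maya.mem_fill, hij, hji, or_self,
        Maya.sgn_fill hi, Maya.sgn_fill hj, S.fill_fill_comm i j, smul_smul, ← neg_smul]
      congr 1
      rcases lt_or_gt_of_ne hij with h | h
      · simp [h, h.not_gt]; ring
      · simp [h, h.not_gt]; ring

theorem psiStar_mul_psiStar (i j : ℤ) :
    psiStar R i * psiStar R j = -(psiStar R j * psiStar R i) := by
  classical
  refine end_ext_ket fun S => ?_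
  simp only [Module.End.mul_apply, LinearMap.neg_apply, psiStar_apply_ket]
  by_cases hi : i ∈ S.carrier <;> by_cases hj : j ∈ S.carrier
  · by_cases hij : i = j
    · subst hij
      simp [hi, psiStar_apply_ket]
    · have hji : ¬ j = i := fun h => hij h.symm
      simp only [hi, hj, if_true, map_smul, psiStar_apply_ket, Maya.mem_clear, hij, hji, ne_eq,
        not_false_eq_true, and_self, 
        Maya.sgn_clear hi, Maya.sgn_clear hj, S.clear_clear_comm i j, smul_smul, ← neg_smul]
      congr 1
      rcases lt_or_gt_of_ne hij with h | h
      · simp [h, h.not_gt]; ring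
      · simp [h, h.not_gt]; ring
  · simp [hi, hj, psiStar_apply_ket]
  · simp [hi, hj, psiStar_apply_ket]
  · simp [hi, hj]

theorem psi_mul_psiStar (i j : ℤ) :
    psi R i * psiStar R j = (if i = j then 1 else 0) - psiStar R j * psi R i := by
  classical
  refine end_ext_ket fun S => ?_
  by_cases hij : i = j
  · subst hij
    simp only [Module.End.mul_apply, LinearMap.sub_apply, psiStar_apply_ket, psi_apply_ket,
      if_true, Module.End.one_apply]
    have hs : (S.sgn i : R) * (S.sgn i : R) = 1 := S.intCast_sgn_mul_self i
    by_cases hi : i ∈ S.carrier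
    · simp [hi, psi_apply_ket, Maya.sgn_clear hi, Maya.fill_clear hi, smul_smul, hs]
    · simp [hi, psiStar_apply_ket, Maya.sgn_fill hi, Maya.clear_fill hi, smul_smul, hs]
  · have hji : ¬ j = i := fun h => hij h.symm
    simp only [Module.End.mul_apply, LinearMap.sub_apply, psiStar_apply_ket, psi_apply_ket,
      if_neg hij, LinearMap.zero_apply, zero_sub]
    by_cases hi : i ∈ S.carrier <;> by_cases hj : j ∈ S.carrier
    · simp [hi, hj, psi_apply_ket, hij]
    · simp [hi, hj]
    · simp only [hi, hj, if_true, if_false, map_smul, psiStar_apply_ket, psi_apply_ket,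
        Maya.mem_clear, Maya.mem_fill, hji, false_and, or_true, 
        Maya.sgn_clear hj, Maya.sgn_fill hi, S.fill_clear_comm hij, smul_smul, ← neg_smul]
      congr 1
      rcases lt_or_gt_of_ne hij with h | h
      · simp [h, h.not_gt]; ring
      · simp [h, h.not_gt]; ring
    · simp [hi, hj, psiStar_apply_ket, hji]

/-- An operator that commutes with all `ψ_i`, `ψ*_i` and annihilates the vacuum is zero, as the
vacuum is cyclic. -/
theorem eq_zero_of_commute {C : Module.End R (Fock R)} (hpsi : ∀ i, C * psi R i = psi R i * C)
    (hstar : ∀ i, C * psiStar R i = psiStar R i * C) (hvac : C (ket R Maya.vac) = 0) : C = 0 := by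
  classical
  refine end_ext_ket fun S => ?_
  rw [LinearMap.zero_apply]
  induction S using Maya.induction_fill_clear with
  | hvac => exact hvac
  | hfill S i hi ih =>
    have h := LinearMap.congr_fun (hpsi i) (ket R S)
    have hs : (S.sgn i : R) * (S.sgn i : R) = 1 := S.intCast_sgn_mul_self i
    simp only [Module.End.mul_apply, psi_apply_ket, hi, if_false, map_smul, ih, map_zero] at h
    have h2 := congrArg (fun x => (S.sgn i : R) • x) h
    simpa [smul_smul, hs] using h2
  | hclear S i hi ih =>
    have h := LinearMap.congr_fun (hstar i) (ket R S)
    have hs : (S.sgn i : R) * (S.sgn i : R) = 1 := S.intCast_sgn_mul_self i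
    simp only [Module.End.mul_apply, psiStar_apply_ket, hi, if_true, map_smul, ih, map_zero] at h
    have h2 := congrArg (fun x => (S.sgn i : R) • x) h
    simpa [smul_smul, hs] using h2

variable (R) in
/-- The diagonal operator with eigenvalue `S.energy` on `|S⟩`. -/
def energyOp : Module.End R (Fock R) :=
  Finsupp.linearCombination R fun S => (S.energy : R) • ket R S

theorem energyOp_ket (S : Maya) : energyOp R (ket R S) = (S.energy : R) • ket R S := by
  simp [energyOp, ket]

theorem energyOp_apply (x : Fock R) (S : Maya) : energyOp R x S = (S.energy : R) * x S := by
  classical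
  induction x using Finsupp.induction_linear with
  | zero => simp
  | add x y hx hy => simp [hx, hy, mul_add]
  | single T r =>
    have : Finsupp.single T r = r • ket R T := by simp [ket]
    rw [this, map_smul, energyOp_ket]
    by_cases h : T = S
    · subst h; simp [ket, mul_comm]
    · simp [ket, h]

theorem energyOp_mul_psi (i : ℤ) :
    energyOp R * psi R i = psi R i * energyOp R + ((2 * i + 1 : ℤ) : R) • psi R i := by
  classical
  refine end_ext_ket fun S => ?_
  simp only [Module.End.mul_apply, LinearMap.add_apply, LinearMap.smul_apply, energyOp_ket,
    map_smul, psi_apply_ket]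
  by_cases hi : i ∈ S.carrier
  · simp [hi]
  · simp only [hi, if_false, map_smul, energyOp_ket, Maya.energy_fill hi, smul_smul, ← add_smul]
    congr 1
    push_cast
    ring

theorem energyOp_mul_psiStar (i : ℤ) :
    energyOp R * psiStar R i = psiStar R i * energyOp R - ((2 * i + 1 : ℤ) : R) • psiStar R i := by
  classical
  refine end_ext_ket fun S => ?_
  simp only [Module.End.mul_apply, LinearMap.sub_apply, LinearMap.smul_apply, energyOp_ket,
    map_smul, psiStar_apply_ket]
  by_cases hi : i ∈ S.carrier
  · simp only [hi, if_true, map_smul, energyOp_ket, Maya.energy_clear hi, smul_smul, ← sub_smul]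
    congr 1
    push_cast
    ring
  · simp [hi]

end CAR

/-! ### Commutation relations of the currents -/

section Currents

open Filter

variable {R : Type*} [CommRing R]

/-- The sums of operators that define the currents, the flow and its exponential are infinite, but
finite on each vector: they agree with their partial sums of order `N` for all large `N`. This lemma
reduces statements of that kind to basis vectors. -/
theorem eventually_eq_of_ket {A : Module.End R (Fock R)} {B : ℕ → Module.End R (Fock R)}
    (h : ∀ S, ∀ᶠ N in atTop, A (ket R S) = B N (ket R S)) (x : Fock R) :
    ∀ᶠ N in atTop, A x = B N x := by
  induction x using Finsupp.induction_linear with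
  | zero => simp
  | add x y hx hy =>
    filter_upwards [hx, hy] with N h1 h2
    rw [map_add, map_add, h1, h2]
  | single S r =>
    have : Finsupp.single S r = r • ket R S := by simp [ket]
    filter_upwards [h S] with N h1
    rw [this, map_smul, map_smul, h1]

/-! The ring identities below are stated for `Module.End R (Fock R)`, since the general ones
are found there by unification only after unfolding instances. -/

theorem end_mul_sub (A B C : Module.End R (Fock R)) : A * (B - C) = A * B - A * C :=
  mul_sub A B C

theorem end_sub_mul (A B C : Module.End R (Fock R)) : (A - B) * C = A * C - B * C :=
  sub_mul A B C

theorem end_mul_neg (A B : Module.End R (Fock R)) : A * -B = -(A * B) :=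
  LinearMap.comp_neg B A

theorem end_neg_mul (A B : Module.End R (Fock R)) : -A * B = -(A * B) :=
  LinearMap.neg_comp B A

theorem end_smul_sub (r : R) (A B : Module.End R (Fock R)) : r • (A - B) = r • A - r • B :=
  smul_sub r A B

theorem normalPair_of_ne {i j : ℤ} (h : i ≠ j) : normalPair R i j = psi R i * psiStar R j := by
  have h1 : psi R i * psiStar R j = -(psiStar R j * psi R i) := by
    rw [psi_mul_psiStar, if_neg h]
    abel
  unfold normalPair
  rw [h1, ite_self]

theorem mem_of_psi_mul_psiStar_ne {i j : ℤ} (hij : i ≠ j) {S : Maya}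
    (h : (psi R i * psiStar R j) (ket R S) ≠ 0) : i ∉ S.carrier ∧ j ∈ S.carrier := by
  classical
  rw [Module.End.mul_apply, psiStar_apply_ket] at h
  split_ifs at h with hj
  · refine ⟨fun hi => h ?_, hj⟩
    rw [map_smul, psi_apply_ket, if_pos (Maya.mem_clear.2 ⟨hi, hij⟩), smul_zero]
  · simp at h

theorem eventually_current {n : ℤ} (hn : 0 < n) (x : Fock R) : ∀ᶠ N : ℕ in atTop,
    current R n x = (∑ j ∈ Finset.Icc (-(N : ℤ)) N, psi R j * psiStar R (j + n)) x := by
  refine eventually_eq_of_ket (fun S => ?_) x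
  obtain ⟨m, M, hm, hM, hS1, hS2⟩ := exists_mem_box S
  filter_upwards [eventually_ge_atTop (m.natAbs + M.natAbs)] with N hN
  have hc : current R n (ket R S) = ∑ᶠ j : ℤ, normalPair R j (j + n) (ket R S) := by
    simp [current, ket]
  have hne : ∀ j, normalPair R j (j + n) = psi R j * psiStar R (j + n) :=
    fun j => normalPair_of_ne (by omega)
  simp only [hne] at hc
  rw [hc, LinearMap.sum_apply]
  refine finsum_eq_sum_of_support_subset _ fun j hj => ?_
  obtain ⟨h1, h2⟩ := mem_of_psi_mul_psiStar_ne (by omega) (Function.mem_support.1 hj)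
  have h3 := hS1 _ h2
  have h4 : m ≤ j := by
    by_contra h
    exact h1 (hS2 j (by omega))
  simp only [Finset.coe_Icc, Set.mem_Icc]
  omega

theorem exists_forall_lt_psi_eq_zero (x : Fock R) : ∃ m : ℤ, ∀ i < m, psi R i x = 0 := by
  classical
  induction x using Finsupp.induction_linear with
  | zero => simp
  | add x y hx hy =>
    obtain ⟨m, hm⟩ := hx
    obtain ⟨m', hm'⟩ := hy
    refine ⟨min m m', fun i hi => ?_⟩
    rw [map_add, hm i (hi.trans_le (min_le_left _ _)), hm' i (hi.trans_le (min_le_right _ _)),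
      add_zero]
  | single S r =>
    have : Finsupp.single S r = r • ket R S := by simp [ket]
    obtain ⟨m, M, hm, hM, hS1, hS2⟩ := exists_mem_box S
    refine ⟨m, fun i hi => ?_⟩
    rw [this, map_smul, psi_apply_ket, if_pos (hS2 i hi), smul_zero]

theorem exists_forall_lt_psiStar_neg_eq_zero (x : Fock R) :
    ∃ m : ℤ, ∀ i < m, psiStar R (-i) x = 0 := by
  classical
  induction x using Finsupp.induction_linear with
  | zero => simp
  | add x y hx hy =>
    obtain ⟨m, hm⟩ := hx
    obtain ⟨m', hm'⟩ := hy
    refine ⟨min m m', fun i hi => ?_⟩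
    rw [map_add, hm i (hi.trans_le (min_le_left _ _)), hm' i (hi.trans_le (min_le_right _ _)),
      add_zero]
  | single S r =>
    have : Finsupp.single S r = r • ket R S := by simp [ket]
    obtain ⟨m, M, hm, hM, hS1, hS2⟩ := exists_mem_box S
    refine ⟨-M, fun i hi => ?_⟩
    rw [this, map_smul, psiStar_apply_ket, if_neg, smul_zero]
    intro h
    have := hS1 _ h
    omega

theorem current_mul_psi {n : ℤ} (hn : 0 < n) (i : ℤ) :
    current R n * psi R i = psi R i * current R n + psi R (i - n) := by
  refine LinearMap.ext fun x => ?_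
  obtain ⟨N, h1, h2, h3⟩ := ((eventually_current hn x).and
    ((eventually_current hn (psi R i x)).and
      (eventually_ge_atTop (i.natAbs + (i - n).natAbs)))).exists
  have key : (∑ j ∈ Finset.Icc (-(N : ℤ)) N, psi R j * psiStar R (j + n)) * psi R i =
      psi R i * (∑ j ∈ Finset.Icc (-(N : ℤ)) N, psi R j * psiStar R (j + n)) + psi R (i - n) := by
    have hterm : ∀ j : ℤ, psi R j * psiStar R (j + n) * psi R i =
        psi R i * (psi R j * psiStar R (j + n)) + if j = i - n then psi R (i - n) else 0 := by
      intro j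
      have e1 : psiStar R (j + n) * psi R i =
          (if i = j + n then 1 else 0) - psi R i * psiStar R (j + n) := by
        rw [psi_mul_psiStar]; abel
      rw [mul_assoc, e1, end_mul_sub, ← mul_assoc, psi_mul_psi j i, end_neg_mul, mul_assoc]
      by_cases h : j = i - n
      · subst h
        rw [if_pos (by omega), if_pos rfl, mul_one]
        abel
      · rw [if_neg h, if_neg (by omega), mul_zero]
        abel
    rw [Finset.sum_mul, Finset.mul_sum, Finset.sum_congr rfl fun j _ => hterm j,
      Finset.sum_add_distrib, Finset.sum_ite_eq', if_pos]
    simp only [Finset.mem_Icc]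
    omega
  rw [Module.End.mul_apply, h2, LinearMap.add_apply, Module.End.mul_apply, h1]
  exact LinearMap.congr_fun key x

theorem current_mul_psiStar {n : ℤ} (hn : 0 < n) (i : ℤ) :
    current R n * psiStar R i = psiStar R i * current R n - psiStar R (i + n) := by
  refine LinearMap.ext fun x => ?_
  obtain ⟨N, h1, h2, h3⟩ := ((eventually_current hn x).and
    ((eventually_current hn (psiStar R i x)).and
      (eventually_ge_atTop i.natAbs))).exists
  have key : (∑ j ∈ Finset.Icc (-(N : ℤ)) N, psi R j * psiStar R (j + n)) * psiStar R i =
      psiStar R i * (∑ j ∈ Finset.Icc (-(N : ℤ)) N, psi R j * psiStar R (j + n))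
        - psiStar R (i + n) := by
    have hterm : ∀ j : ℤ, psi R j * psiStar R (j + n) * psiStar R i =
        psiStar R i * (psi R j * psiStar R (j + n)) +
          if j = i then -psiStar R (i + n) else 0 := by
      intro j
      rw [mul_assoc, psiStar_mul_psiStar, end_mul_neg, ← mul_assoc, psi_mul_psiStar, end_sub_mul,
        mul_assoc]
      by_cases h : j = i
      · subst h
        rw [if_pos rfl, if_pos rfl, one_mul]
        abel
      · rw [if_neg h, if_neg h, zero_mul]
        abel
    rw [Finset.sum_mul, Finset.mul_sum, Finset.sum_congr rfl fun j _ => hterm j,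
      Finset.sum_add_distrib, Finset.sum_ite_eq', if_pos]
    · abel
    simp only [Finset.mem_Icc]
    omega
  rw [Module.End.mul_apply, h2, LinearMap.sub_apply, Module.End.mul_apply, h1]
  exact LinearMap.congr_fun key x

theorem current_vac {n : ℤ} (hn : 0 < n) : current R n (ket R Maya.vac) = 0 := by
  obtain ⟨N, h⟩ := (eventually_current hn (ket R Maya.vac)).exists
  rw [h, LinearMap.sum_apply]
  refine Finset.sum_eq_zero fun j _ => ?_
  by_contra hne
  have := mem_of_psi_mul_psiStar_ne (by omega) hne
  simp only [Maya.mem_vac] at this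
  omega

/-- The commutator of `J_m` and `J_n` commutes with all `ψ_i` and `ψ*_i`, and `J_m`, `J_n`
annihilate the vacuum. -/
theorem current_mul_current {m n : ℤ} (hm : 0 < m) (hn : 0 < n) :
    current R m * current R n = current R n * current R m := by
  refine sub_eq_zero.1 (eq_zero_of_commute (fun i => ?_) (fun i => ?_) ?_)
  · have h1 := current_mul_psi (R := R) hm
    have h2 := current_mul_psi (R := R) hn
    simp only [end_sub_mul, end_mul_sub, mul_assoc, h1, h2, mul_add]
    simp only [← mul_assoc, h1, h2, add_mul, sub_right_comm i m n]
    abel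
  · have h1 := current_mul_psiStar (R := R) hm
    have h2 := current_mul_psiStar (R := R) hn
    simp only [end_sub_mul, end_mul_sub, mul_assoc, h1, h2]
    simp only [← mul_assoc, h1, h2, end_sub_mul, add_right_comm i m n]
    abel
  · simp [current_vac hm, current_vac hn]

/-- `J_n` lowers the energy by `n`. -/
theorem energyOp_mul_current {n : ℤ} (hn : 0 < n) :
    energyOp R * current R n = current R n * energyOp R - ((2 * n : ℤ) : R) • current R n := by
  rw [← sub_eq_zero]
  refine eq_zero_of_commute (fun i => ?_) (fun i => ?_) ?_
  · have h1 := current_mul_psi (R := R) hn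
    have h2 := energyOp_mul_psi (R := R)
    simp only [end_sub_mul, end_mul_sub, mul_assoc, h1, h2, mul_add, smul_mul_assoc,
      mul_smul_comm]
    simp only [← mul_assoc, h1, h2, add_mul]
    simp only [smul_add, Int.cast_add, Int.cast_mul, Int.cast_sub, smul_mul_assoc]
    module
  · have h1 := current_mul_psiStar (R := R) hn
    have h2 := energyOp_mul_psiStar (R := R)
    simp only [end_sub_mul, end_mul_sub, mul_assoc, h1, h2, smul_mul_assoc, mul_smul_comm]
    simp only [← mul_assoc, h1, h2, end_sub_mul]
    simp only [end_smul_sub, Int.cast_add, Int.cast_mul, smul_mul_assoc]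
    module
  · simp [current_vac hn, energyOp_ket, Maya.energy_vac]

end Currents

/-! ### The exponential `γ̂₊` and the Euler relation -/

section Flow

open Filter

variable {R : Type*} [CommRing R]

variable (R) in
/-- The span of the basis vectors of energy less than `n / 2`. -/
def energyLT (n : ℤ) : Submodule R (Fock R) := Finsupp.supported R R {S | S.energy < n}

theorem mem_energyLT {n : ℤ} {x : Fock R} :
    x ∈ energyLT R n ↔ ∀ S, x S ≠ 0 → S.energy < n := by
  simp only [energyLT, Finsupp.mem_supported, Set.subset_def, Finset.mem_coe,
    Finsupp.mem_support_iff, Set.mem_ofPred_eq]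

theorem energyLT_mono {m n : ℤ} (h : m ≤ n) : energyLT R m ≤ energyLT R n :=
  fun _ hx => mem_energyLT.2 fun S hS => (mem_energyLT.1 hx S hS).trans_le h

theorem eq_zero_of_mem_energyLT {n : ℤ} (hn : n ≤ 0) {x : Fock R} (hx : x ∈ energyLT R n) :
    x = 0 := by
  ext S
  by_contra h
  have h1 := mem_energyLT.1 hx S h
  have h2 := S.energy_nonneg
  omega

theorem exists_mem_energyLT (x : Fock R) : ∃ n : ℕ, x ∈ energyLT R n := by
  refine ⟨∑ S ∈ x.support, (S.energy.toNat + 1), mem_energyLT.2 fun S hS => ?_⟩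
  have h1 : S.energy.toNat + 1 ≤ ∑ S ∈ x.support, (S.energy.toNat + 1) :=
    Finset.single_le_sum (f := fun S : Maya => S.energy.toNat + 1) (fun _ _ => Nat.zero_le _)
      (Finsupp.mem_support_iff.2 hS)
  omega

theorem apply_mem_of_ket {M : Type*} [AddCommGroup M] [Module R M] {n : ℤ} {A : Fock R →ₗ[R] M}
    {W : Submodule R M}
    (h : ∀ S : Maya, S.energy < n → A (ket R S) ∈ W) {x : Fock R} (hx : x ∈ energyLT R n) :
    A x ∈ W := by
  have : A x = ∑ S ∈ x.support, x S • A (ket R S) := by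
    conv_lhs => rw [← Finsupp.sum_single x, Finsupp.sum, map_sum]
    refine Finset.sum_congr rfl fun S _ => ?_
    rw [← map_smul]
    simp [ket]
  rw [this]
  exact Submodule.sum_mem _ fun S hS => Submodule.smul_mem _ _
    (h S (mem_energyLT.1 hx S (Finsupp.mem_support_iff.1 hS)))

variable [Algebra ℚ R]

theorem isUnit_intCast {n : ℤ} (hn : n ≠ 0) : IsUnit (n : R) := by
  have h : IsUnit (n : ℚ) := isUnit_iff_ne_zero.2 (by exact_mod_cast hn)
  simpa using h.map (algebraMap ℚ R)

theorem energy_of_current_ne {n : ℤ} (hn : 0 < n) {S T : Maya}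
    (h : (current R n (ket R S)) T ≠ 0) : T.energy = S.energy - 2 * n := by
  have h1 := DFunLike.congr_fun (LinearMap.congr_fun (energyOp_mul_current (R := R) hn) (ket R S)) T
  simp only [Module.End.mul_apply, LinearMap.sub_apply, LinearMap.smul_apply, energyOp_ket,
    map_smul, energyOp_apply, Finsupp.sub_apply, Finsupp.smul_apply, smul_eq_mul] at h1
  by_contra hne
  have h2 : ((T.energy - (S.energy - 2 * n) : ℤ) : R) * (current R n (ket R S)) T = 0 := by
    push_cast at h1 ⊢
    linear_combination h1
  exact h ((isUnit_intCast (sub_ne_zero.2 hne)).mul_right_eq_zero.1 h2)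

theorem current_mem_energyLT {n : ℤ} (hn : 0 < n) {m : ℤ} {x : Fock R} (hx : x ∈ energyLT R m) :
    current R n x ∈ energyLT R (m - 2 * n) :=
  apply_mem_of_ket (fun S hS => mem_energyLT.2 fun T hT => by
    have := energy_of_current_ne hn hT
    omega) hx

theorem eventually_flow (t : ℕ → R) (x : Fock R) : ∀ᶠ N in atTop,
    flow t x = (∑ k ∈ Finset.range N, t (k + 1) • current R ((k : ℤ) + 1)) x := by
  refine eventually_eq_of_ket (fun S => ?_) x
  obtain ⟨m, hm⟩ := exists_mem_energyLT (ket R S)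
  filter_upwards [eventually_ge_atTop m] with N hN
  have hc : flow t (ket R S) =
      ∑ᶠ k : ℕ, t (k + 1) • current R ((k : ℤ) + 1) (ket R S) := by
    simp [flow, ket]
  rw [hc, LinearMap.sum_apply]
  refine finsum_eq_sum_of_support_subset _ fun k hk => ?_
  by_contra hkN
  rw [Finset.coe_range, Set.mem_Iio, not_lt] at hkN
  refine hk ?_
  simp only
  rw [eq_zero_of_mem_energyLT (by omega) (current_mem_energyLT (by omega) hm), smul_zero]

theorem flow_mem_energyLT (t : ℕ → R) {m : ℤ} {x : Fock R} (hx : x ∈ energyLT R m) :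
    flow t x ∈ energyLT R (m - 1) := by
  obtain ⟨N, h⟩ := (eventually_flow t x).exists
  rw [h, LinearMap.sum_apply]
  exact Submodule.sum_mem _ fun k _ => Submodule.smul_mem _ _
    (energyLT_mono (by omega) (current_mem_energyLT (by omega) hx))

theorem flow_pow_mem_energyLT (t : ℕ → R) (n : ℕ) {m : ℤ} {x : Fock R} (hx : x ∈ energyLT R m) :
    (flow t ^ n) x ∈ energyLT R (m - n) := by
  induction n with
  | zero => simpa using hx
  | succ n ih =>
    rw [pow_succ', Module.End.mul_apply]
    have := flow_mem_energyLT t ih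
    rwa [sub_sub, ← Nat.cast_succ] at this

theorem flow_vac (t : ℕ → R) : flow t (ket R Maya.vac) = 0 := by
  obtain ⟨N, h⟩ := (eventually_flow t (ket R Maya.vac)).exists
  rw [h, LinearMap.sum_apply]
  exact Finset.sum_eq_zero fun k _ => by
    rw [LinearMap.smul_apply, current_vac (by omega), smul_zero]

theorem flow_mul_current (t : ℕ → R) {n : ℤ} (hn : 0 < n) :
    flow t * current R n = current R n * flow t := by
  refine LinearMap.ext fun x => ?_
  obtain ⟨N, h1, h2⟩ := ((eventually_flow t x).and (eventually_flow t (current R n x))).exists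
  rw [Module.End.mul_apply, h2, Module.End.mul_apply, h1, ← Module.End.mul_apply,
    ← Module.End.mul_apply, Finset.sum_mul, Finset.mul_sum]
  congr 1
  exact Finset.sum_congr rfl fun k _ => by
    rw [smul_mul_assoc, mul_smul_comm, current_mul_current (by omega) hn]

theorem flow_mul_flow (s t : ℕ → R) : flow s * flow t = flow t * flow s := by
  refine LinearMap.ext fun x => ?_
  obtain ⟨N, h1, h2⟩ := ((eventually_flow t x).and (eventually_flow t (flow s x))).exists
  rw [Module.End.mul_apply, Module.End.mul_apply, h2, h1, ← Module.End.mul_apply,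
    ← Module.End.mul_apply, Finset.sum_mul, Finset.mul_sum]
  congr 1
  exact Finset.sum_congr rfl fun k _ => by
    rw [smul_mul_assoc, mul_smul_comm, flow_mul_current s (by omega)]

theorem energyOp_mul_flow {t d : ℕ → R} (hd : ∀ k : ℕ, d (k + 1) = ((k : R) + 1) * t (k + 1)) :
    energyOp R * flow t = flow t * energyOp R - (2 : R) • flow d := by
  refine LinearMap.ext fun x => ?_
  obtain ⟨N, h1, h2, h3⟩ := ((eventually_flow t x).and ((eventually_flow t (energyOp R x)).and
    (eventually_flow d x))).exists
  rw [Module.End.mul_apply, LinearMap.sub_apply, Module.End.mul_apply, LinearMap.smul_apply,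
    h2, h1, h3]
  simp only [LinearMap.sum_apply, map_sum, Finset.smul_sum, ← Finset.sum_sub_distrib]
  refine Finset.sum_congr rfl fun k _ => ?_
  have h4 := LinearMap.congr_fun (energyOp_mul_current (R := R) (n := (k : ℤ) + 1) (by omega)) x
  simp only [Module.End.mul_apply, LinearMap.sub_apply, LinearMap.smul_apply] at h4
  rw [LinearMap.smul_apply, LinearMap.smul_apply, LinearMap.smul_apply, map_smul, h4, hd]
  push_cast
  module

/-- `[F^n, E] = n F^{n-1} D`, where `F = flow t` commutes with `D = flow d`; the factor two
accounts for the normalization of `energyOp`. For `n = 0` the truncated exponent `n - 1` does not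
matter. -/
theorem flow_pow_mul_energyOp {t d : ℕ → R}
    (hd : ∀ k : ℕ, d (k + 1) = ((k : R) + 1) * t (k + 1)) (n : ℕ) :
    flow t ^ n * energyOp R =
      energyOp R * flow t ^ n + (2 * n : R) • (flow t ^ (n - 1) * flow d) := by
  induction n with
  | zero => simp
  | succ n ih =>
    have h1 : flow t * energyOp R = energyOp R * flow t + (2 : R) • flow d := by
      rw [energyOp_mul_flow hd]; abel
    have h2 : (2 * n : R) • (flow t * (flow t ^ (n - 1) * flow d)) =
        (2 * n : R) • (flow t ^ n * flow d) := by
      rcases n with _ | n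
      · simp
      · rw [← mul_assoc, Nat.add_sub_cancel, ← pow_succ']
    have h3 : flow d * flow t ^ n = flow t ^ n * flow d :=
      Commute.pow_right (flow_mul_flow d t) n
    rw [pow_succ', mul_assoc, ih, mul_add, ← mul_assoc, h1, add_mul, mul_smul_comm, h2,
      smul_mul_assoc, h3, mul_assoc, Nat.add_sub_cancel]
    push_cast
    module

/-- The covector `⟨0| γ̂₊(t)`. -/
def vacGamma (t : ℕ → R) : Fock R →ₗ[R] R := Finsupp.lapply Maya.vac ∘ₗ gammaPlus t

theorem eventually_gammaPlus (t : ℕ → R) (x : Fock R) : ∀ᶠ N in atTop,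
    gammaPlus t x = (∑ n ∈ Finset.range N, ((n ! : ℚ)⁻¹) • flow t ^ n) x := by
  refine eventually_eq_of_ket (fun S => ?_) x
  obtain ⟨m, hm⟩ := exists_mem_energyLT (ket R S)
  filter_upwards [eventually_ge_atTop m] with N hN
  have hc : gammaPlus t (ket R S) = ∑ᶠ n : ℕ, ((n ! : ℚ)⁻¹) • ((flow t ^ n) (ket R S)) := by
    simp [gammaPlus, ket]
  rw [hc, LinearMap.sum_apply]
  refine finsum_eq_sum_of_support_subset _ fun k hk => ?_
  by_contra hkN
  rw [Finset.coe_range, Set.mem_Iio, not_lt] at hkN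
  refine hk ?_
  simp only
  rw [eq_zero_of_mem_energyLT (by omega) (flow_pow_mem_energyLT t k hm), smul_zero]

theorem eventually_vacGamma (t : ℕ → R) (x : Fock R) : ∀ᶠ N in atTop,
    vacGamma t x = ∑ n ∈ Finset.range N, ((n ! : ℚ)⁻¹) • ((flow t ^ n) x Maya.vac) := by
  filter_upwards [eventually_gammaPlus t x] with N hN
  rw [vacGamma, LinearMap.comp_apply, hN, LinearMap.sum_apply, map_sum]
  exact Finset.sum_congr rfl fun n _ => rfl

theorem vacGamma_vac (t : ℕ → R) : vacGamma t (ket R Maya.vac) = 1 := by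
  obtain ⟨N, h, hN⟩ := ((eventually_vacGamma t (ket R Maya.vac)).and
    (eventually_ge_atTop 1)).exists
  rw [h, Finset.sum_eq_single_of_mem 0 (by simp; omega)]
  · simp [ket]
  · intro n _ hn
    obtain ⟨k, rfl⟩ := Nat.exists_eq_succ_of_ne_zero hn
    rw [pow_succ, Module.End.mul_apply, flow_vac, map_zero, Finsupp.zero_apply, smul_zero]

/-- The Euler relation: `⟨0| γ̂₊(t)` is homogeneous if `t_k` has degree `k`, and the Euler vector
field acts on it as `∑ k t_k J_k`. -/
theorem vacGamma_energyOp {t d : ℕ → R} (hd : ∀ k : ℕ, d (k + 1) = ((k : R) + 1) * t (k + 1))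
    (x : Fock R) : vacGamma t (energyOp R x) = 2 * vacGamma t (flow d x) := by
  have hev := (eventually_vacGamma t (energyOp R x))
  obtain ⟨N, h1, h2⟩ := (((tendsto_add_atTop_nat 1).eventually hev).and
    (eventually_vacGamma t (flow d x))).exists
  rw [h1, h2, Finset.sum_range_succ', Finset.mul_sum]
  have h0 : ∀ y : Fock R, (energyOp R y) Maya.vac = 0 := by
    intro y
    rw [energyOp_apply, Maya.energy_vac, Int.cast_zero, zero_mul]
  rw [pow_zero, Module.End.one_apply, h0, smul_zero, add_zero]
  refine Finset.sum_congr rfl fun n _ => ?_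
  rw [← Module.End.mul_apply, flow_pow_mul_energyOp hd, LinearMap.add_apply, Module.End.mul_apply,
    Finsupp.add_apply, h0, zero_add, LinearMap.smul_apply, Finsupp.smul_apply, Nat.add_sub_cancel,
    Module.End.mul_apply, smul_eq_mul, Nat.factorial_succ, Algebra.smul_def, Algebra.smul_def]
  have h3 : algebraMap ℚ R (((n + 1) * n ! : ℕ) : ℚ)⁻¹ * ((n + 1 : ℕ) : R)
      = algebraMap ℚ R ((n ! : ℚ)⁻¹) := by
    rw [← map_natCast (algebraMap ℚ R), ← map_mul]
    congr 1
    push_cast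
    field_simp
  rw [← h3]
  ring

end Flow

/-! ### Dressed fermions -/

section Dressed

open Filter

variable {R : Type*} [CommRing R]

/-- The operator `∑_{k ≥ 0} c^k χ_{i-k}` for a family of operators `χ` such that, on each vector,
`χ_i` vanishes for all sufficiently negative `i`. -/
def geomSum (χ : ℤ → Module.End R (Fock R)) (c : R) (i : ℤ) : Module.End R (Fock R) :=
  Finsupp.linearCombination R fun S => ∑ᶠ k : ℕ, c ^ k • χ (i - k) (ket R S)

variable {χ : ℤ → Module.End R (Fock R)} (hχ : ∀ x, ∃ m : ℤ, ∀ i < m, χ i x = 0)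
include hχ

theorem eventually_geomSum (c : R) (i : ℤ) (x : Fock R) : ∀ᶠ N in atTop,
    geomSum χ c i x = (∑ k ∈ Finset.range N, c ^ k • χ (i - k)) x := by
  refine eventually_eq_of_ket (fun S => ?_) x
  obtain ⟨m, hm⟩ := hχ (ket R S)
  filter_upwards [eventually_ge_atTop ((i - m).natAbs + 1)] with N hN
  have hc : geomSum χ c i (ket R S) = ∑ᶠ k : ℕ, c ^ k • χ (i - k) (ket R S) := by
    simp [geomSum, ket]
  rw [hc, LinearMap.sum_apply]
  refine finsum_eq_sum_of_support_subset _ fun k hk => ?_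
  by_contra hkN
  rw [Finset.coe_range, Set.mem_Iio, not_lt] at hkN
  refine hk ?_
  simp only
  rw [hm _ (by omega), smul_zero]

theorem geomSum_apply (c : R) (i : ℤ) (x : Fock R) :
    geomSum χ c i x = χ i x + c • geomSum χ c (i - 1) x := by
  obtain ⟨N, h1, h2⟩ := (((tendsto_add_atTop_nat 1).eventually (eventually_geomSum hχ c i x)).and
    (eventually_geomSum hχ c (i - 1) x)).exists
  rw [h1, h2, LinearMap.sum_apply, LinearMap.sum_apply, Finset.sum_range_succ', Finset.smul_sum,
    add_comm]
  congr 1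
  · simp
  · refine Finset.sum_congr rfl fun k _ => ?_
    rw [LinearMap.smul_apply, LinearMap.smul_apply, smul_smul, pow_succ', Nat.cast_succ,
      sub_sub, add_comm (k : ℤ) 1]

theorem geomSum_eq_zero {m : ℤ} {x : Fock R} (hm : ∀ i < m, χ i x = 0) (c : R) {i : ℤ}
    (hi : i < m) : geomSum χ c i x = 0 := by
  obtain ⟨N, h⟩ := (eventually_geomSum hχ c i x).exists
  rw [h, LinearMap.sum_apply]
  exact Finset.sum_eq_zero fun k _ => by rw [LinearMap.smul_apply, hm _ (by omega), smul_zero]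

/-- Let `χ_i` have weight `i + ε/2` for the energy, and let
`[D, χ_i] = ∑_{k ≥ 1} (a^k - b^k) χ_{i-k}`.
Then the image of `χ_i` under `(1 - aT)/(1 - bT)`, where `T χ_i = χ_{i-1}`, is an eigenvector of
weight `i + ε/2` for the commutator with half of `energyOp R - 2 D`. The defect of this identity at
`i` is `b` times the defect at `i - 1`, and it vanishes for `i → -∞`. -/
theorem euler_commutator_dressed {a b : R} {D : Module.End R (Fock R)} {ε : ℤ}
    (hE : ∀ i x, energyOp R (χ i x) = χ i (energyOp R x) + ((2 * i + ε : ℤ) : R) • χ i x)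
    (hD : ∀ i x, D (χ i x) = χ i (D x) + a • geomSum χ a (i - 1) x - b • geomSum χ b (i - 1) x)
    (i : ℤ) (x : Fock R) :
    energyOp R (geomSum χ b i x - a • geomSum χ b (i - 1) x)
        - (2 : R) • D (geomSum χ b i x - a • geomSum χ b (i - 1) x) =
      (geomSum χ b i (energyOp R x) - a • geomSum χ b (i - 1) (energyOp R x))
        - (2 : R) • (geomSum χ b i (D x) - a • geomSum χ b (i - 1) (D x))
        + ((2 * i + ε : ℤ) : R) • (geomSum χ b i x - a • geomSum χ b (i - 1) x) := by
  set Q : ℤ → Fock R → Fock R := fun i x => geomSum χ b i x - a • geomSum χ b (i - 1) x with hQ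
  have hQs : ∀ i x, Q i x = b • Q (i - 1) x + (χ i x - a • χ (i - 1) x) := by
    intro i x
    simp only [hQ]
    rw [geomSum_apply hχ b i x, geomSum_apply hχ b (i - 1) x]
    module
  set H : ℤ → Fock R := fun i => energyOp R (Q i x) - (2 : R) • D (Q i x)
    - ((Q i (energyOp R x) - (2 : R) • Q i (D x)) + ((2 * i + ε : ℤ) : R) • Q i x) with hH
  have hHs : ∀ i, H i = b • H (i - 1) := by
    intro i
    have hg := geomSum_apply hχ a (i - 1) x
    have hq : Q (i - 1) x = geomSum χ b (i - 1) x - a • geomSum χ b (i - 1 - 1) x := rfl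
    simp only [hH]
    rw [hQs i x, hQs i (energyOp R x), hQs i (D x)]
    simp only [map_add, map_sub, map_smul, hE, hD]
    rw [hg]
    have hq' : b • geomSum χ b (i - 1) x =
        b • Q (i - 1) x + (b * a) • geomSum χ b (i - 1 - 1) x := by
      rw [hq]; module
    rw [hq']
    push_cast
    module
  have hH0 : ∀ n : ℕ, H i = b ^ n • H (i - n) := by
    intro n
    induction n with
    | zero => simp
    | succ n ih =>
      rw [ih, hHs (i - n), smul_smul, ← pow_succ, Nat.cast_succ, sub_sub]
  obtain ⟨m1, h1⟩ := hχ x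
  obtain ⟨m2, h2⟩ := hχ (energyOp R x)
  obtain ⟨m3, h3⟩ := hχ (D x)
  have hQ0 : ∀ {m j : ℤ} {y : Fock R}, (∀ i < m, χ i y = 0) → j < m → Q j y = 0 := by
    intro m j y hm hj
    simp only [hQ]
    rw [geomSum_eq_zero hχ hm b hj, geomSum_eq_zero hχ hm b (by omega), smul_zero, sub_zero]
  have hfin : H i = 0 := by
    rw [hH0 ((i - m1).natAbs + (i - m2).natAbs + (i - m3).natAbs + 1)]
    simp only [hH]
    rw [hQ0 h1 (by omega), hQ0 h2 (by omega), hQ0 h3 (by omega)]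
    simp
  exact sub_eq_zero.1 hfin

/-- Under the hypotheses of `euler_commutator_dressed`, a covector that satisfies the Euler relation
annihilates the image of the dressed `χ_i` if `i + ε/2 > 0`, since all energies are nonnegative. -/
theorem apply_geomSum [Algebra ℚ R] {a b : R} {D : Module.End R (Fock R)} {ε : ℤ}
    (hE : ∀ i x, energyOp R (χ i x) = χ i (energyOp R x) + ((2 * i + ε : ℤ) : R) • χ i x)
    (hD : ∀ i x, D (χ i x) = χ i (D x) + a • geomSum χ a (i - 1) x - b • geomSum χ b (i - 1) x)
    (hlow : ∀ m : ℤ, ∀ x ∈ energyLT R m, D x ∈ energyLT R (m - 1))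
    {u : Fock R →ₗ[R] R} (hu : ∀ x, u (energyOp R x) = 2 * u (D x))
    {i : ℤ} (hi : 0 < 2 * i + ε) (x : Fock R) :
    u (geomSum χ b i x) = a * u (geomSum χ b (i - 1) x) := by
  set v : Fock R →ₗ[R] R := u ∘ₗ (geomSum χ b i - a • geomSum χ b (i - 1)) with hv
  have hvx : ∀ x, v x = u (geomSum χ b i x - a • geomSum χ b (i - 1) x) := fun x => rfl
  have hrel : ∀ x, v (energyOp R x) + ((2 * i + ε : ℤ) : R) * v x = 2 * v (D x) := by
    intro x
    have h := congrArg u (euler_commutator_dressed hχ hE hD i x)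
    rw [map_sub, map_smul, hu, smul_eq_mul, sub_self, map_add, map_sub, map_smul, map_smul,
      smul_eq_mul, smul_eq_mul, ← hvx, ← hvx, ← hvx] at h
    linear_combination -h
  have key : ∀ m : ℕ, ∀ x ∈ energyLT R m, v x = 0 := by
    intro m
    induction m with
    | zero =>
      intro x hx
      rw [eq_zero_of_mem_energyLT (by simp) hx, map_zero]
    | succ m ih =>
      intro x hx
      refine (Submodule.mem_bot R).1 (apply_mem_of_ket (fun S hS => (Submodule.mem_bot R).2 ?_) hx)
      have hmem : ket R S ∈ energyLT R (m + 1) := by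
        classical
        refine mem_energyLT.2 fun T hT => ?_
        have : T = S := by
          by_contra hne
          exact hT (Finsupp.single_eq_of_ne hne)
        rw [this]
        exact_mod_cast hS
      have h := hrel (ket R S)
      have hD0 := ih _ (by simpa using hlow _ _ hmem)
      rw [hD0, energyOp_ket, map_smul, smul_eq_mul, mul_zero, ← add_mul, ← Int.cast_add] at h
      refine (isUnit_intCast ?_).mul_right_eq_zero.1 h
      have := S.energy_nonneg
      omega
  obtain ⟨m, hm⟩ := exists_mem_energyLT x
  have h := key m x hm
  rw [hvx, map_sub, map_smul, smul_eq_mul] at h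
  exact sub_eq_zero.1 h

/-- Recovers `u χ_i` from the geometric sums, as `χ_i` is the difference of the geometric sum at `i`
and `b` times the one at `i - 1`. -/
theorem apply_eq_of_geomSum {a b : R} {u : Fock R →ₗ[R] R} {i₀ : ℤ} {x : Fock R}
    (h : ∀ i, i₀ < i → u (geomSum χ b i x) = a * u (geomSum χ b (i - 1) x)) (n : ℕ) :
    u (χ (i₀ + 1 + n) x) = (a - b) * a ^ n * u (geomSum χ b i₀ x) := by
  have h1 : ∀ n : ℕ, u (geomSum χ b (i₀ + n) x) = a ^ n * u (geomSum χ b i₀ x) := by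
    intro n
    induction n with
    | zero => simp
    | succ n ih =>
      rw [h _ (by push_cast; omega), show i₀ + (n + 1 : ℕ) - 1 = i₀ + n by push_cast; omega, ih]
      ring
  have h2 := h1 (n + 1)
  have h3 := h1 n
  rw [geomSum_apply hχ, map_add, map_smul,
    show i₀ + (n + 1 : ℕ) - 1 = i₀ + n by push_cast; omega, h3, smul_eq_mul,
    show i₀ + (n + 1 : ℕ) = i₀ + 1 + n by push_cast; omega] at h2
  linear_combination h2

end Dressed

/-! ### The hook formula -/

section Hook

open Filter

variable {R : Type*} [CommRing R]

theorem ket_eq_psi {S : Maya} {j : ℤ} (hj : j ∈ S.carrier) :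
    ket R S = (S.sgn j : R) • psi R j (ket R (S.clear j)) := by
  rw [psi_apply_ket, if_neg (by simp), Maya.sgn_clear hj, if_neg (lt_irrefl j), smul_smul,
    Maya.intCast_sgn_mul_self, one_smul, Maya.fill_clear hj]

theorem ket_eq_psiStar {S : Maya} {i : ℤ} (hi : i ∉ S.carrier) :
    ket R S = (S.sgn i : R) • psiStar R i (ket R (S.fill i)) := by
  rw [psiStar_apply_ket, if_pos (by simp), Maya.sgn_fill hi, if_neg (lt_irrefl i), smul_smul,
    Maya.intCast_sgn_mul_self, one_smul, Maya.clear_fill hi]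

variable [Algebra ℚ R] {a b : R} {t : ℕ → R}

theorem flow_psi (i : ℤ) (x : Fock R) :
    flow (fun k => a ^ k - b ^ k) (psi R i x) = psi R i (flow (fun k => a ^ k - b ^ k) x)
      + a • geomSum (psi R) a (i - 1) x - b • geomSum (psi R) b (i - 1) x := by
  obtain ⟨N, h1, h2, h3, h4⟩ := ((eventually_flow (fun k => a ^ k - b ^ k) x).and
    ((eventually_flow (fun k => a ^ k - b ^ k) (psi R i x)).and
    ((eventually_geomSum exists_forall_lt_psi_eq_zero a (i - 1) x).and
    (eventually_geomSum exists_forall_lt_psi_eq_zero b (i - 1) x)))).exists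
  rw [h1, h2, h3, h4]
  simp only [LinearMap.sum_apply, map_sum, Finset.smul_sum, ← Finset.sum_sub_distrib,
    ← Finset.sum_add_distrib]
  refine Finset.sum_congr rfl fun k _ => ?_
  have h := LinearMap.congr_fun (current_mul_psi (R := R) (n := (k : ℤ) + 1) (by omega) i) x
  simp only [Module.End.mul_apply, LinearMap.add_apply] at h
  simp only [LinearMap.smul_apply, map_smul, h]
  rw [show i - ((k : ℤ) + 1) = i - 1 - k by ring, pow_succ, pow_succ]
  module

theorem flow_psiStar (i : ℤ) (x : Fock R) :
    flow (fun k => a ^ k - b ^ k) (psiStar R (-i) x) =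
      psiStar R (-i) (flow (fun k => a ^ k - b ^ k) x)
        + b • geomSum (fun n => psiStar R (-n)) b (i - 1) x
        - a • geomSum (fun n => psiStar R (-n)) a (i - 1) x := by
  obtain ⟨N, h1, h2, h3, h4⟩ := ((eventually_flow (fun k => a ^ k - b ^ k) x).and
    ((eventually_flow (fun k => a ^ k - b ^ k) (psiStar R (-i) x)).and
    ((eventually_geomSum exists_forall_lt_psiStar_neg_eq_zero a (i - 1) x).and
    (eventually_geomSum exists_forall_lt_psiStar_neg_eq_zero b (i - 1) x)))).exists
  rw [h1, h2, h3, h4]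
  simp only [LinearMap.sum_apply, map_sum, Finset.smul_sum, ← Finset.sum_sub_distrib,
    ← Finset.sum_add_distrib]
  refine Finset.sum_congr rfl fun k _ => ?_
  have h := LinearMap.congr_fun (current_mul_psiStar (R := R) (n := (k : ℤ) + 1) (by omega) (-i)) x
  simp only [Module.End.mul_apply, LinearMap.sub_apply] at h
  simp only [LinearMap.smul_apply, map_smul, h]
  rw [show -i + ((k : ℤ) + 1) = -(i - 1 - k) by ring, pow_succ, pow_succ]
  module

variable (ht : ∀ k : ℕ, a ^ (k + 1) - b ^ (k + 1) = ((k : R) + 1) * t (k + 1))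
include ht

/-- Under `⟨0| γ̂₊(t)` a particle at `n ≥ 0` is distributed over the sites `m < 0`, with weights
`(a - b) a^n b^{-m-1}`. -/
theorem vacGamma_psi (n : ℕ) (x : Fock R) :
    vacGamma t (psi R n x) = (a - b) * a ^ n * vacGamma t (geomSum (psi R) b (-1) x) := by
  have h := apply_eq_of_geomSum (χ := psi R) exists_forall_lt_psi_eq_zero (a := a) (b := b)
    (u := vacGamma t) (i₀ := -1) (x := x) (fun i hi =>
      apply_geomSum exists_forall_lt_psi_eq_zero (D := flow (fun k => a ^ k - b ^ k)) (ε := 1)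
        (fun i x => by
          have h := LinearMap.congr_fun (energyOp_mul_psi (R := R) i) x
          simpa only [Module.End.mul_apply, LinearMap.add_apply, LinearMap.smul_apply] using h)
        flow_psi (fun m x hx => flow_mem_energyLT _ hx)
        (vacGamma_energyOp (d := fun k => a ^ k - b ^ k) ht) (by omega) x) n
  simpa using h

/-- The particle-hole dual of `vacGamma_psi`: apply the dressing to `χ_i = ψ*_{-i}`, which exchanges
the roles of `a` and `b`. -/
theorem vacGamma_psiStar (n : ℕ) (x : Fock R) :
    vacGamma t (psiStar R (-1 - n) x) =
      (b - a) * b ^ n * vacGamma t (geomSum (fun n => psiStar R (-n)) a 0 x) := by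
  have h := apply_eq_of_geomSum (χ := fun n => psiStar R (-n)) exists_forall_lt_psiStar_neg_eq_zero
    (a := b) (b := a) (u := vacGamma t) (i₀ := 0) (x := x) (fun i hi =>
      apply_geomSum exists_forall_lt_psiStar_neg_eq_zero (D := flow (fun k => a ^ k - b ^ k))
        (ε := -1)
        (fun i x => by
          have h := LinearMap.congr_fun (energyOp_mul_psiStar (R := R) (-i)) x
          simp only [Module.End.mul_apply, LinearMap.sub_apply, LinearMap.smul_apply] at h
          rw [h, sub_eq_add_neg, ← neg_smul, ← Int.cast_neg]
          congr 3
          ring)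
        flow_psiStar (fun m x hx => flow_mem_energyLT _ hx)
        (vacGamma_energyOp (d := fun k => a ^ k - b ^ k) ht) (by omega) x) n
  rw [← h, zero_add, neg_add, sub_eq_add_neg]

end Hook

namespace Maya

/-- The diagram with a single hole `i < 0` and a single particle `j ≥ 0`; its partition is a
hook. -/
def hook (i j : ℤ) : Maya := (vac.clear i).fill j

/-- The sign of `ψ_i ψ*_j |hook i j⟩ = ± |0⟩`. -/
def hookSign (i j : ℤ) : ℤ := (hook i j).sgn j * (vac.clear i).sgn i

theorem mem_hook {i j k : ℤ} : k ∈ (hook i j).carrier ↔ k = j ∨ (k < 0 ∧ k ≠ i) :=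
  Iff.rfl

theorem hook_clear {i j : ℤ} (hj : 0 ≤ j) : (hook i j).clear j = vac.clear i :=
  clear_fill (by simp; omega)

theorem hook_injective {i j i' j' : ℤ} (hi : i < 0) (hj : 0 ≤ j) (hj' : 0 ≤ j')
    (h : hook i j = hook i' j') : i = i' ∧ j = j' := by
  have h1 : j ∈ (hook i' j').carrier := h ▸ mem_hook.2 (Or.inl rfl)
  have h2 : i ∉ (hook i' j').carrier := by
    rw [← h, mem_hook]
    omega
  rw [mem_hook] at h1 h2
  omega

theorem hook_ne_vac {i j : ℤ} (hj : 0 ≤ j) : hook i j ≠ vac := by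
  intro h
  have h1 : j ∈ vac.carrier := h ▸ mem_hook.2 (Or.inl rfl)
  rw [mem_vac] at h1
  omega

end Maya

section Hook

open Filter Maya

variable {R : Type*} [CommRing R]

theorem matEl_psi_mul_psiStar_hook {i j : ℤ} (hi : i < 0) (hj : 0 ≤ j) :
    matEl (psi R i * psiStar R j) vac (hook i j) = (hookSign i j : R) := by
  have h1 : (vac.clear i).fill i = vac := fill_clear (by simpa using hi)
  rw [matEl, Module.End.mul_apply, psiStar_apply_ket, if_pos (mem_hook.2 (Or.inl rfl)),
    hook_clear hj, map_smul, psi_apply_ket, if_neg (by simp), h1, hookSign]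
  simp [ket]

theorem matEl_psi_mul_psiStar_vac (i j : ℤ) :
    matEl (psi R i * psiStar R j) vac vac = if i = j ∧ i < 0 then 1 else 0 := by
  classical
  rw [matEl, Module.End.mul_apply, psiStar_apply_ket]
  by_cases hj : j < 0
  · rw [if_pos (mem_vac.2 hj), map_smul, psi_apply_ket]
    by_cases hij : i = j
    · subst hij
      rw [if_neg (by simp), fill_clear (mem_vac.2 hj), sgn_clear (mem_vac.2 hj),
        if_neg (lt_irrefl i), smul_smul, intCast_sgn_mul_self, if_pos ⟨rfl, hj⟩]
      simp [ket]
    · rw [if_neg (c := i = j ∧ i < 0) (fun h => hij h.1)]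
      by_cases h : i ∈ (vac.clear j).carrier
      · rw [if_pos h]
        simp
      · have : (vac.clear j).fill i ≠ vac := by
          intro h'
          have h2 : j ∈ vac.carrier := mem_vac.2 hj
          rw [← h', mem_fill, mem_clear] at h2
          tauto
        simp [h, ket, this]
  · rw [if_neg (by simpa using hj), if_neg (by omega)]
    simp

theorem matEl_psi_mul_psiStar_of_ne {i j : ℤ} {S : Maya} (hS : S ≠ vac)
    (h : ¬(i < 0 ∧ 0 ≤ j ∧ S = hook i j)) : matEl (psi R i * psiStar R j) vac S = 0 := by
  classical
  rw [matEl, Module.End.mul_apply, psiStar_apply_ket]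
  split_ifs with hj
  · rw [map_smul, psi_apply_ket]
    split_ifs with hi
    · simp
    · have : (S.clear j).fill i ≠ vac := by
        intro h'
        have hm : ∀ k, (k = i ∨ (k ∈ S.carrier ∧ k ≠ j)) ↔ k < 0 := fun k => by
          rw [← mem_vac, ← h']
          rfl
        rw [mem_clear] at hi
        have hi0 : i < 0 := (hm i).1 (Or.inl rfl)
        by_cases hij : i = j
        · subst hij
          exact hS (by rw [← h', fill_clear hj])
        · have hiS : i ∉ S.carrier := fun h => hi ⟨h, hij⟩
          have hj0 : 0 ≤ j := by
            by_contra hlt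
            have := (hm j).2 (by omega)
            grind
          refine h ⟨hi0, hj0, ?_⟩
          ext k
          rw [mem_hook]
          have := hm k
          grind
      simp [ket, this]
  · simp

variable [Algebra ℚ R] {a b : R} {t : ℕ → R}

variable (ht : ∀ k : ℕ, a ^ (k + 1) - b ^ (k + 1) = ((k : R) + 1) * t (k + 1))
include ht

theorem vacGamma_hook {i j : ℤ} (hi : i < 0) (hj : 0 ≤ j) : vacGamma t (ket R (hook i j)) =
    (hookSign i j : R) * ((a - b) * a ^ j.toNat * b ^ (-1 - i).toNat) := by
  classical
  have hji : (j.toNat : ℤ) = j := Int.toNat_of_nonneg hj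
  have hgeom : geomSum (psi R) b (-1) (ket R (vac.clear i)) =
      (b ^ (-1 - i).toNat * ((vac.clear i).sgn i : R)) • ket R vac := by
    obtain ⟨N, h, hN⟩ := ((eventually_geomSum exists_forall_lt_psi_eq_zero b (-1)
      (ket R (vac.clear i))).and (eventually_ge_atTop ((-1 - i).toNat + 1))).exists
    rw [h, LinearMap.sum_apply, Finset.sum_eq_single_of_mem (-1 - i).toNat (by simp; omega)]
    · rw [LinearMap.smul_apply, show -1 - ((-1 - i).toNat : ℤ) = i by omega, psi_apply_ket,
        if_neg (by simp), fill_clear (by simpa using hi), smul_smul]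
    · intro k _ hk
      rw [LinearMap.smul_apply, psi_apply_ket, if_pos, smul_zero]
      rw [mem_clear, mem_vac]
      omega
  have h := vacGamma_psi ht j.toNat (ket R (vac.clear i))
  rw [hji, hgeom, map_smul, vacGamma_vac, smul_eq_mul] at h
  rw [ket_eq_psi (mem_hook.2 (Or.inl rfl)), map_smul, hook_clear hj, h, hookSign, smul_eq_mul]
  push_cast
  ring

/-- The covector vanishes on diagrams that are neither the vacuum nor a hook: two particles (or two
holes) can be moved to the same site, a particle without holes has no site to fall to, and
likewise for a hole without particles. -/
theorem vacGamma_of_ne {S : Maya} (hS : S ≠ vac) (h : ∀ i j, i < 0 → 0 ≤ j → S ≠ hook i j) :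
    vacGamma t (ket R S) = 0 := by
  classical
  by_cases hp : ∃ j, 0 ≤ j ∧ j ∈ S.carrier
  · obtain ⟨j, hj0, hj⟩ := hp
    -- a second particle `p < q`: up to a power of `a`, `ψ_q` may be replaced by `ψ_p`, which
    -- annihilates the rest
    by_cases hp2 : ∃ j', 0 ≤ j' ∧ j' ∈ S.carrier ∧ j' ≠ j
    · obtain ⟨p, q, hp0, hpq, hpS, hqS⟩ : ∃ p q : ℕ, p < q ∧ p ≠ q ∧ (p : ℤ) ∈ S.carrier ∧
          (q : ℤ) ∈ S.carrier := by
        obtain ⟨j', hj'0, hj', hne⟩ := hp2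
        lift j to ℕ using hj0
        lift j' to ℕ using hj'0
        rcases lt_trichotomy j j' with hlt | heq | hlt
        · exact ⟨j, j', hlt, hlt.ne, hj, hj'⟩
        · exact absurd (congrArg Nat.cast heq.symm) hne
        · exact ⟨j', j, hlt, hlt.ne, hj', hj⟩
      have h1 := vacGamma_psi ht q (ket R (S.clear q))
      have h2 := vacGamma_psi ht p (ket R (S.clear q))
      rw [psi_apply_ket (p : ℤ), if_pos (mem_clear.2 ⟨hpS, by exact_mod_cast hpq⟩), map_zero] at h2
      have h3 : a ^ q = a ^ p * a ^ (q - p) := by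
        rw [← pow_add]; congr 1; omega
      rw [ket_eq_psi hqS, map_smul, h1, smul_eq_mul, h3]
      linear_combination (-((S.sgn q : ℤ) : R) * a ^ (q - p)) * h2
    · have hp3 : ∀ k, 0 ≤ k → k ∈ S.carrier → k = j := by
        intro k hk0 hk
        by_contra hne
        exact hp2 ⟨k, hk0, hk, hne⟩
      by_cases hh : ∃ i, i < 0 ∧ i ∉ S.carrier
      · obtain ⟨i, hi0, hi⟩ := hh
        -- `S` is not a hook, so that there is a second hole
        obtain ⟨i', hi'0, hi', hne⟩ : ∃ i', i' < 0 ∧ i' ∉ S.carrier ∧ i' ≠ i := by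
          by_contra hcon
          refine h i j hi0 hj0 ?_
          ext k
          rw [mem_hook]
          grind
        obtain ⟨p, q, hpq, hpS, hqS⟩ : ∃ p q : ℕ, p < q ∧ (-1 - p : ℤ) ∉ S.carrier ∧
            (-1 - q : ℤ) ∉ S.carrier := by
          obtain ⟨n, rfl⟩ : ∃ n : ℕ, i = -1 - n := ⟨(-1 - i).toNat, by omega⟩
          obtain ⟨n', rfl⟩ : ∃ n : ℕ, i' = -1 - n := ⟨(-1 - i').toNat, by omega⟩
          rcases lt_trichotomy n n' with hlt | heq | hlt
          · exact ⟨n, n', hlt, hi, hi'⟩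
          · omega
          · exact ⟨n', n, hlt, hi', hi⟩
        have h1 := vacGamma_psiStar ht q (ket R (S.fill (-1 - q)))
        have h2 := vacGamma_psiStar ht p (ket R (S.fill (-1 - q)))
        rw [psiStar_apply_ket (-1 - p : ℤ), if_neg, map_zero] at h2
        · rw [ket_eq_psiStar hqS, map_smul, h1, smul_eq_mul]
          have h3 : b ^ q = b ^ p * b ^ (q - p) := by
            rw [← pow_add]; congr 1; omega
          rw [h3]
          linear_combination (-((S.sgn (-1 - q) : ℤ) : R) * b ^ (q - p)) * h2
        · rw [mem_fill]
          rintro (h3 | h3)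
          · omega
          · exact hpS h3
      · have h1 := vacGamma_psi ht j.toNat (ket R (S.clear j))
        have h2 : geomSum (psi R) b (-1) (ket R (S.clear j)) = 0 := by
          refine geomSum_eq_zero exists_forall_lt_psi_eq_zero (m := 0) (fun i hi => ?_) b (by omega)
          rw [psi_apply_ket, if_pos (mem_clear.2 ⟨?_, by omega⟩)]
          by_contra hiS
          exact hh ⟨i, hi, hiS⟩
        rw [Int.toNat_of_nonneg hj0, h2, map_zero, mul_zero] at h1
        rw [ket_eq_psi hj, map_smul, h1, smul_zero]
  · obtain ⟨i, hi0, hi⟩ : ∃ i, i < 0 ∧ i ∉ S.carrier := by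
      by_contra hcon
      refine hS ?_
      ext k
      rw [mem_vac]
      grind
    obtain ⟨n, rfl⟩ : ∃ n : ℕ, i = -1 - n := ⟨(-1 - i).toNat, by omega⟩
    have h1 := vacGamma_psiStar ht n (ket R (S.fill (-1 - n)))
    have h2 : geomSum (fun n => psiStar R (-n)) a 0 (ket R (S.fill (-1 - n))) = 0 := by
      refine geomSum_eq_zero exists_forall_lt_psiStar_neg_eq_zero (m := 1) (fun k hk => ?_) a
        (by omega)
      rw [psiStar_apply_ket, if_neg]
      rw [mem_fill]
      rintro (h3 | h3)
      · omega
      · exact hp ⟨-k, by omega, h3⟩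
    rw [h2, map_zero, mul_zero] at h1
    rw [ket_eq_psiStar hi, map_smul, h1, smul_zero]

end Hook

/-! ### Vacuum expectation values of pairs -/

section Pairs

open Maya

theorem support_matEl_psi_mul_psiStar (i j : ℤ) :
    (Function.support fun S => matEl (psi ℂ i * psiStar ℂ j) vac S) ⊆ {vac, hook i j} := by
  intro S hS
  by_contra h
  simp only [Set.mem_insert_iff, Set.mem_singleton_iff, not_or] at h
  exact hS (matEl_psi_mul_psiStar_of_ne h.1 fun h' => h.2 h'.2.2)

theorem vev_psi_mul_psiStar (i j : ℤ) (G : CFock → CFock) : vev (psi ℂ i * psiStar ℂ j) G =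
    (if i = j ∧ i < 0 then orbitVec G vac else 0) +
      if i < 0 ∧ 0 ≤ j then (hookSign i j : ℂ) * orbitVec G (hook i j) else 0 := by
  unfold vev
  by_cases h : i < 0 ∧ 0 ≤ j
  · rw [finsum_eq_single _ (hook i j), matEl_psi_mul_psiStar_hook h.1 h.2, if_neg (by omega),
      if_pos h, zero_add]
    intro S hS
    by_cases hv : S = vac
    · rw [hv, matEl_psi_mul_psiStar_vac, if_neg (by omega), zero_mul]
    · rw [matEl_psi_mul_psiStar_of_ne hv fun h' => hS h'.2.2, zero_mul]
  · rw [finsum_eq_single _ vac, matEl_psi_mul_psiStar_vac, if_neg h, add_zero, ite_mul, one_mul,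
      zero_mul]
    intro S hS
    rw [matEl_psi_mul_psiStar_of_ne hS fun h' => h ⟨h'.1, h'.2.1⟩, zero_mul]

theorem vev_neg_psiStar_mul_psi (i j : ℤ) (G : CFock → CFock) :
    vev (-(psiStar ℂ j * psi ℂ i)) G =
      vev (psi ℂ i * psiStar ℂ j) G - if i = j then orbitVec G vac else 0 := by
  classical
  have hop : -(psiStar ℂ j * psi ℂ i) = psi ℂ i * psiStar ℂ j - if i = j then 1 else 0 := by
    rw [psi_mul_psiStar]; abel
  have hmat : ∀ S, matEl (-(psiStar ℂ j * psi ℂ i)) vac S * orbitVec G S =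
      matEl (psi ℂ i * psiStar ℂ j) vac S * orbitVec G S
        - if S = vac then (if i = j then orbitVec G vac else 0) else 0 := by
    intro S
    rw [hop]
    by_cases hS : S = vac
    · subst hS
      by_cases hij : i = j <;> simp [matEl, hij, ket, sub_mul]
    · by_cases hij : i = j <;> simp [matEl, hij, ket, hS]
  unfold vev
  rw [finsum_congr hmat, finsum_sub_distrib]
  · congr 1
    rw [finsum_eq_single _ vac fun S hS => if_neg hS, if_pos rfl]
  · exact (((Set.finite_singleton _).insert _).subset (support_matEl_psi_mul_psiStar i j)).subset
      fun S hS => left_ne_zero_of_mul hS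
  · refine (Set.finite_singleton vac).subset fun S hS => ?_
    by_contra h
    exact hS (if_neg h)

end Pairs

/-! ### The identity for complex numbers -/

section Numeric

open Maya

theorem matEl_gammaPlus {R : Type*} [CommRing R] [Algebra ℚ R] (t : ℕ → R) (S : Maya) :
    matEl (gammaPlus t) vac S = vacGamma t (ket R S) :=
  rfl

theorem mul_miwa (z w : ℂ) (k : ℕ) :
    w⁻¹ ^ (k + 1) - z⁻¹ ^ (k + 1) = ((k : ℂ) + 1) * miwa z w (k + 1) := by
  have : (k : ℂ) + 1 ≠ 0 := Nat.cast_add_one_ne_zero k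
  rw [miwa]
  push_cast
  field_simp

/-- The terms of the expansion of `1 / (z - w)`, which is the coefficient of `⟨0|` in the pair
covector. They lie on the diagonal, at the indices `< 0` if `|w| < |z|` and, with the opposite sign,
at the indices `≥ 0` otherwise. -/
def diagTerm (z w : ℂ) (p : ℤ × ℤ) : ℂ :=
  if p.1 = p.2 then
    z ^ p.1 * w ^ (-p.2 - 1) * ((if p.1 < 0 then 1 else 0) - if ‖w‖ < ‖z‖ then 0 else 1)
  else 0

theorem hasSum_diagTerm {z w : ℂ} (hz : z ≠ 0) (hw : w ≠ 0) (h : ‖z‖ ≠ ‖w‖) :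
    HasSum (diagTerm z w) (1 / (z - w)) := by
  have hzw : z - w ≠ 0 := fun h0 => h (by rw [sub_eq_zero.1 h0])
  rcases lt_or_gt_of_ne h with hlt | hlt
  · have hinj : Function.Injective fun n : ℕ => ((n : ℤ), (n : ℤ)) := fun m n hmn => by
      simpa using hmn
    rw [← hinj.hasSum_iff]
    · have h1 : ‖z / w‖ < 1 := by
        rw [norm_div, div_lt_one (norm_pos_iff.2 hw)]
        exact hlt
      have h2 := (hasSum_geometric_of_norm_lt_one h1).mul_left (-w⁻¹)
      have hwz : w - z ≠ 0 := by rwa [← neg_sub, neg_ne_zero]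
      have h3 : -w⁻¹ * (1 - z / w)⁻¹ = 1 / (z - w) := by
        rw [one_sub_div hw, inv_div, ← neg_sub w z]
        field_simp
      rw [h3] at h2
      refine h2.congr_fun fun n => ?_
      simp only [Function.comp_apply, diagTerm, if_true, if_neg hlt.not_gt]
      rw [if_neg (by omega), show -(n : ℤ) - 1 = -((n + 1 : ℕ) : ℤ) by push_cast; ring,
        zpow_neg, zpow_natCast, zpow_natCast, div_pow, pow_succ]
      field_simp
      ring
    · rintro ⟨i, j⟩ hp
      unfold diagTerm
      split_ifs with h1 h2 h3 h3 <;> simp only at *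
      · exact absurd h3 hlt.not_gt
      · simp
      · exact absurd h3 hlt.not_gt
      · exact absurd ⟨i.toNat, by ext <;> simp <;> omega⟩ hp
  · have hinj : Function.Injective fun n : ℕ => (-1 - (n : ℤ), -1 - (n : ℤ)) := fun m n hmn => by
      simpa using hmn
    rw [← hinj.hasSum_iff]
    · have h1 : ‖w / z‖ < 1 := by
        rw [norm_div, div_lt_one (norm_pos_iff.2 hz)]
        exact hlt
      have h2 := (hasSum_geometric_of_norm_lt_one h1).mul_left (z⁻¹)
      have h3 : z⁻¹ * (1 - w / z)⁻¹ = 1 / (z - w) := by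
        rw [one_sub_div hz, inv_div]
        field_simp
      rw [h3] at h2
      refine h2.congr_fun fun n => ?_
      simp only [Function.comp_apply, diagTerm, if_true, if_pos hlt]
      rw [if_pos (by omega), show -1 - (n : ℤ) = -((n + 1 : ℕ) : ℤ) by push_cast; ring,
        zpow_neg, zpow_natCast, div_pow, pow_succ,
        show -(-((n + 1 : ℕ) : ℤ)) - 1 = n by push_cast; ring, zpow_natCast]
      field_simp
      ring
    · rintro ⟨i, j⟩ hp
      unfold diagTerm
      split_ifs with h1 h2 <;> simp only at *
      · exact absurd ⟨(-1 - i).toNat, by ext <;> simp <;> omega⟩ hp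
      · simp

/-- The pairs `(i, j)` with `hook i j` a hook: hole `i < 0`, particle `j ≥ 0`. -/
def hookPairs : Set (ℤ × ℤ) := {p | p.1 < 0 ∧ 0 ≤ p.2}

open Classical in
/-- The part of the double series that comes from the hooks. -/
def hookTerm (G : CFock → CFock) (z w : ℂ) (p : ℤ × ℤ) : ℂ :=
  if p ∈ hookPairs then
    z ^ p.1 * w ^ (-p.2 - 1) * ((hookSign p.1 p.2 : ℂ) * orbitVec G (hook p.1 p.2)) else 0

open Classical in
/-- The terms of the series for `τ_g`, with the vacuum term replaced by zero. -/
def tauTermNeVac (G : CFock → CFock) (t : ℕ → ℂ) (S : Maya) : ℂ :=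
  if S = vac then 0 else tauTerm G t S

theorem pairTerm_eq (G : CFock → CFock) (z w : ℂ) (p : ℤ × ℤ) :
    pairTerm G z w p = diagTerm z w p * orbitVec G vac + hookTerm G z w p := by
  have hp : p ∈ hookPairs ↔ p.1 < 0 ∧ 0 ≤ p.2 := Iff.rfl
  unfold pairTerm orderedPair diagTerm hookTerm
  simp only [hp]
  by_cases h : ‖w‖ < ‖z‖
  · rw [if_pos h, if_pos h, vev_psi_mul_psiStar]
    by_cases h1 : p.1 = p.2 <;> by_cases h2 : p.1 < 0 <;> by_cases h3 : 0 ≤ p.2 <;>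
      simp [h1, h2, h3] <;> grind
  · rw [if_neg h, if_neg h, vev_neg_psiStar_mul_psi, vev_psi_mul_psiStar]
    by_cases h1 : p.1 = p.2 <;> by_cases h2 : p.1 < 0 <;> by_cases h3 : 0 ≤ p.2 <;>
      simp [h1, h2, h3] <;> grind

theorem tauTerm_hook (G : CFock → CFock) {z w : ℂ} (hz : z ≠ 0) (hw : w ≠ 0) {i j : ℤ}
    (hi : i < 0) (hj : 0 ≤ j) : tauTerm G (miwa z w) (hook i j) =
      (z - w) * (z ^ i * w ^ (-j - 1) * ((hookSign i j : ℂ) * orbitVec G (hook i j))) := by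
  rw [tauTerm, matEl_gammaPlus, vacGamma_hook (mul_miwa z w) hi hj]
  obtain ⟨n, rfl⟩ : ∃ n : ℕ, i = -((n + 1 : ℕ) : ℤ) := ⟨(-1 - i).toNat, by omega⟩
  lift j to ℕ using hj
  rw [show (-1 - -((n + 1 : ℕ) : ℤ)).toNat = n by omega, Int.toNat_natCast,
    show -(j : ℤ) - 1 = -((j + 1 : ℕ) : ℤ) by push_cast; ring, zpow_neg, zpow_neg, zpow_natCast,
    zpow_natCast, inv_pow, inv_pow, pow_succ, pow_succ]
  field_simp

theorem hasSum_hookTerm_iff (G : CFock → CFock) {z w : ℂ} (hz : z ≠ 0) (hw : w ≠ 0)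
    (h : ‖z‖ ≠ ‖w‖) (s : ℂ) :
    HasSum (hookTerm G z w) s ↔ HasSum (tauTermNeVac G (miwa z w)) ((z - w) * s) := by
  have hzw : z - w ≠ 0 := fun h0 => h (by rw [sub_eq_zero.1 h0])
  have hinj : Function.Injective fun p : hookPairs => hook p.1.1 p.1.2 := fun p q hpq => by
    have := hook_injective p.2.1 p.2.2 q.2.2 hpq
    exact Subtype.ext (Prod.ext this.1 this.2)
  have hsupp : Function.support (hookTerm G z w) ⊆ hookPairs := fun p hp => by
    by_contra hne
    exact hp (if_neg hne)
  rw [← hasSum_subtype_iff_of_support_subset hsupp, ← hasSum_mul_left_iff hzw, ← hinj.hasSum_iff]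
  · have hfun : (fun p : hookPairs => (z - w) * (hookTerm G z w ∘ Subtype.val) p) =
        tauTermNeVac G (miwa z w) ∘ fun p : hookPairs => hook p.1.1 p.1.2 := by
      funext p
      simp only [Function.comp_apply, hookTerm, tauTermNeVac]
      rw [if_pos p.2, if_neg (hook_ne_vac p.2.2), tauTerm_hook G hz hw p.2.1 p.2.2]
    rw [hfun]
  · intro S hS
    unfold tauTermNeVac
    split_ifs with hv
    · rfl
    · rw [tauTerm, matEl_gammaPlus, vacGamma_of_ne (mul_miwa z w) hv, zero_mul]
      rintro i j hi hj rfl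
      exact hS ⟨⟨(i, j), hi, hj⟩, rfl⟩

theorem hasSum_pairTerm_iff (G : CFock → CFock) {z w : ℂ} (hz : z ≠ 0) (hw : w ≠ 0)
    (h : ‖z‖ ≠ ‖w‖) (s : ℂ) :
    HasSum (pairTerm G z w) s ↔ HasSum (tauTerm G (miwa z w)) ((z - w) * s) := by
  classical
  have hzw : z - w ≠ 0 := fun h0 => h (by rw [sub_eq_zero.1 h0])
  have hd := (hasSum_diagTerm hz hw h).mul_right (orbitVec G vac)
  have hv := hasSum_ite_eq vac (orbitVec G vac)
  have hτ : ∀ S, tauTerm G (miwa z w) S =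
      (if S = vac then orbitVec G vac else 0) + tauTermNeVac G (miwa z w) S := by
    intro S
    unfold tauTermNeVac
    by_cases hS : S = vac
    · rw [if_pos hS, if_pos hS, hS, tauTerm, matEl_gammaPlus, vacGamma_vac, one_mul, add_zero]
    · rw [if_neg hS, if_neg hS, zero_add]
  have hs : (z - w) * s - orbitVec G vac = (z - w) * (s - 1 / (z - w) * orbitVec G vac) := by
    field_simp
  constructor
  · intro hp
    have h1 : HasSum (hookTerm G z w) (s - 1 / (z - w) * orbitVec G vac) :=
      (hp.sub hd).congr_fun fun p => by rw [pairTerm_eq]; ring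
    have h2 := hv.add ((hasSum_hookTerm_iff G hz hw h _).1 h1)
    rw [← hs, add_sub_cancel] at h2
    exact h2.congr_fun hτ
  · intro ht
    have h1 : HasSum (tauTermNeVac G (miwa z w)) ((z - w) * s - orbitVec G vac) :=
      (ht.sub hv).congr_fun fun S => by rw [hτ]; ring
    rw [hs, ← hasSum_hookTerm_iff G hz hw h] at h1
    have h2 := hd.add h1
    rw [add_sub_cancel] at h2
    exact h2.congr_fun fun p => pairTerm_eq G z w p

theorem summable_pairTerm_iff (G : CFock → CFock) {z w : ℂ} (hz : z ≠ 0) (hw : w ≠ 0)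
    (h : ‖z‖ ≠ ‖w‖) : Summable (pairTerm G z w) ↔ Summable (tauTerm G (miwa z w)) := by
  have hzw : z - w ≠ 0 := fun h0 => h (by rw [sub_eq_zero.1 h0])
  constructor
  · rintro ⟨s, hs⟩
    exact ⟨_, (hasSum_pairTerm_iff G hz hw h s).1 hs⟩
  · rintro ⟨s, hs⟩
    refine ⟨s / (z - w), (hasSum_pairTerm_iff G hz hw h _).2 ?_⟩
    rwa [mul_div_cancel₀ _ hzw]

theorem pairCorrelator_eq (G : CFock → CFock) {z w : ℂ} (hz : z ≠ 0) (hw : w ≠ 0)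
    (h : ‖z‖ ≠ ‖w‖) : pairCorrelator G z w = tau G (miwa z w) / (z - w) := by
  have hzw : z - w ≠ 0 := fun h0 => h (by rw [sub_eq_zero.1 h0])
  by_cases hs : Summable (pairTerm G z w)
  · rw [eq_div_iff hzw, mul_comm]
    exact ((hasSum_pairTerm_iff G hz hw h _).1 hs.hasSum).tsum_eq.symm
  · rw [pairCorrelator, tau, tsum_eq_zero_of_not_summable hs,
      tsum_eq_zero_of_not_summable (mt (summable_pairTerm_iff G hz hw h).2 hs), zero_div]

/-- The covector identity is the identity of series for the vector `|S⟩` in place of `ĝ|0⟩`. -/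
theorem hasSum_matEl_orderedPair {z w : ℂ} (hz : z ≠ 0) (hw : w ≠ 0) (h : ‖z‖ ≠ ‖w‖)
    (S : Maya) :
    HasSum (fun p : ℤ × ℤ => z ^ p.1 * w ^ (-p.2 - 1) * matEl (orderedPair z w p.1 p.2) vac S)
      (matEl (gammaPlus (miwa z w)) vac S / (z - w)) := by
  classical
  have hzw : z - w ≠ 0 := fun h0 => h (by rw [sub_eq_zero.1 h0])
  set G : CFock → CFock := fun _ T => if T = S then 1 else 0 with hG
  have ho : ∀ T, orbitVec G T = if T = S then 1 else 0 := fun _ => rfl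
  have h1 : HasSum (pairTerm G z w) (matEl (gammaPlus (miwa z w)) vac S / (z - w)) := by
    rw [hasSum_pairTerm_iff G hz hw h, mul_div_cancel₀ _ hzw]
    have h2 := hasSum_single (f := tauTerm G (miwa z w)) S fun T hT => by
      rw [tauTerm, ho, if_neg hT, mul_zero]
    rwa [tauTerm, ho, if_pos rfl, mul_one] at h2
  refine h1.congr_fun fun p => ?_
  rw [pairTerm, vev, finsum_eq_single _ S fun T hT => by rw [ho, if_neg hT, mul_zero], ho,
    if_pos rfl, mul_one]

end Numeric

/-! ### The identity for formal series -/

section Formal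

open Maya

theorem mul_formalMiwa (k : ℕ) :
    (AddMonoidAlgebra.single (0, -1) 1 : LaurentZW) ^ (k + 1)
      - AddMonoidAlgebra.single (-1, 0) 1 ^ (k + 1) =
        ((k : LaurentZW) + 1) * formalMiwa (k + 1) := by
  have h : ((k : LaurentZW) + 1) = algebraMap ℚ LaurentZW ((k + 1 : ℕ) : ℚ) := by
    rw [map_natCast, Nat.cast_succ]
  rw [formalMiwa, h, ← Algebra.smul_def, smul_smul, mul_inv_cancel₀ (by positivity), one_smul,
    AddMonoidAlgebra.single_pow, AddMonoidAlgebra.single_pow]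
  simp

/-- The covector `⟨0| γ̂₊([w⁻¹] - [z⁻¹])` is `z - w` times `⟨0| ψ(z) ψ*(w)`, coefficientwise. -/
theorem coeff_matEl_gammaPlus (S : Maya) (α β : ℤ) :
    (matEl (gammaPlus formalMiwa) vac S).coeff (α, β) =
      matEl (psi ℂ (α - 1) * psiStar ℂ (-β - 1)) vac S
        - matEl (psi ℂ α * psiStar ℂ (-(β - 1) - 1)) vac S := by
  rw [matEl_gammaPlus]
  by_cases hS : S = vac
  · rw [hS, vacGamma_vac, matEl_psi_mul_psiStar_vac, matEl_psi_mul_psiStar_vac,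
      AddMonoidAlgebra.one_def, AddMonoidAlgebra.coeff_single, Finsupp.single_apply]
    simp only [Prod.ext_iff, Prod.fst_zero, Prod.snd_zero]
    split_ifs <;> first | omega | simp
  · by_cases hh : ∃ i j, i < 0 ∧ 0 ≤ j ∧ S = hook i j
    · obtain ⟨i, j, hi, hj, rfl⟩ := hh
      have hmat : ∀ i' j', matEl (psi ℂ i' * psiStar ℂ j') vac (hook i j) =
          if i = i' ∧ j = j' then (hookSign i j : ℂ) else 0 := by
        intro i' j'
        split_ifs with h
        · rw [← h.1, ← h.2, matEl_psi_mul_psiStar_hook hi hj]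
        · exact matEl_psi_mul_psiStar_of_ne hS fun h' => h (hook_injective hi hj h'.2.1 h'.2.2)
      have hc : ∀ x : LaurentZW, (((hookSign i j : ℤ) : LaurentZW) * x).coeff (α, β) =
          (hookSign i j : ℂ) * x.coeff (α, β) := by
        intro x
        rw [← zsmul_eq_mul, AddMonoidAlgebra.coeff_smul]
        simp
      rw [vacGamma_hook mul_formalMiwa hi hj, hmat, hmat, hc, AddMonoidAlgebra.single_pow,
        AddMonoidAlgebra.single_pow, sub_mul, sub_mul]
      simp only [AddMonoidAlgebra.single_mul_single, AddMonoidAlgebra.coeff_sub,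
        AddMonoidAlgebra.coeff_single, Finsupp.sub_apply, Finsupp.single_apply, Prod.smul_mk,
        Prod.mk_add_mk, Prod.mk.injEq, one_pow, mul_one, smul_zero, nsmul_eq_mul, mul_sub, mul_ite,
        mul_zero]
      congr 1 <;> refine if_congr ?_ rfl rfl <;> omega
    · have h2 : ∀ i' j', matEl (psi ℂ i' * psiStar ℂ j') vac S = 0 := fun i' j' =>
        matEl_psi_mul_psiStar_of_ne hS fun h' => hh ⟨i', j', h'⟩
      rw [vacGamma_of_ne mul_formalMiwa hS fun i j hi hj hSij => hh ⟨i, j, hi, hj, hSij⟩, h2, h2]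
      simp

theorem formalTau_eq_outer (G : CFock → CFock) (α β : ℤ) :
    formalTau G α β = formalPairOuter G (α - 1) β - formalPairOuter G α (β - 1) := by
  have hfin : ∀ i j, (Function.support fun S =>
      matEl (psi ℂ i * psiStar ℂ j) vac S * orbitVec G S).Finite := fun i j =>
    (((Set.finite_singleton _).insert _).subset (support_matEl_psi_mul_psiStar i j)).subset
      fun S hS => left_ne_zero_of_mul hS
  unfold formalTau formalPairOuter vev
  rw [← finsum_sub_distrib (hfin _ _) (hfin _ _)]
  exact finsum_congr fun S => by rw [coeff_matEl_gammaPlus, sub_mul]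

theorem formalPairInner_eq (G : CFock → CFock) (α β : ℤ) : formalPairInner G α β =
    formalPairOuter G α β - if α = -β - 1 then orbitVec G vac else 0 :=
  vev_neg_psiStar_mul_psi _ _ G

theorem formalTau_eq_inner (G : CFock → CFock) (α β : ℤ) :
    formalTau G α β = formalPairInner G (α - 1) β - formalPairInner G α (β - 1) := by
  rw [formalTau_eq_outer, formalPairInner_eq, formalPairInner_eq]
  split_ifs <;> first | omega | ring

/-- Division by `z - w` in the expansion for `|z| > |w|`, of a series without nonnegative powers
of `z`. -/
theorem seriesMul_cauchyOuter {K f : ℤ → ℤ → ℂ} (hf : ∀ a b, f a b = K (a - 1) b - K a (b - 1))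
    (hK : ∀ a b, 0 ≤ a → K a b = 0) : seriesMul cauchyOuter f = K := by
  classical
  funext a b
  unfold seriesMul
  have hinj : Function.Injective fun n : ℕ => (-1 - (n : ℤ), (n : ℤ)) := fun m n hmn => by
    simpa using hmn
  rw [finsum_eq_sum_of_support_subset (s := (Finset.range (a.natAbs + 1)).image
    fun n : ℕ => (-1 - (n : ℤ), (n : ℤ)))]
  · rw [Finset.sum_image fun _ _ _ _ h => hinj h]
    have hterm : ∀ n : ℕ, cauchyOuter (-1 - n) n * f (a - (-1 - n)) (b - n) =
        K (a + n) (b - n) - K (a + (n + 1 : ℕ)) (b - (n + 1 : ℕ)) := by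
      intro n
      rw [cauchyOuter, if_pos (by omega), one_mul, hf]
      congr 2 <;> (push_cast; ring)
    rw [Finset.sum_congr rfl fun n _ => hterm n,
      Finset.sum_range_sub' fun n : ℕ => K (a + n) (b - n),
      hK (a + (a.natAbs + 1 : ℕ)) _ (by omega)]
    simp
  · rintro ⟨p, q⟩ hpq
    have h1 : p < 0 ∧ q = -p - 1 := by
      by_contra h
      exact hpq (by simp [cauchyOuter, h])
    have h2 : a - p ≤ 0 := by
      by_contra h
      refine hpq ?_
      simp only
      rw [hf, hK _ _ (by omega), hK _ _ (by omega), sub_zero, mul_zero]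
    simp only [Finset.coe_image, Set.mem_image, Finset.coe_range, Set.mem_Iio, Prod.mk.injEq]
    exact ⟨(-1 - p).toNat, by omega, by omega, by omega⟩

/-- Division by `z - w` in the expansion for `|z| < |w|`. -/
theorem seriesMul_cauchyInner {K f : ℤ → ℤ → ℂ} (hf : ∀ a b, f a b = K (a - 1) b - K a (b - 1))
    (hK : ∀ a b, a < 0 → 0 ≤ b → K a b = 0) : seriesMul cauchyInner f = K := by
  classical
  funext a b
  unfold seriesMul
  have hinj : Function.Injective fun n : ℕ => ((n : ℤ), -1 - (n : ℤ)) := fun m n hmn => by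
    simpa using hmn
  rw [finsum_eq_sum_of_support_subset (s := (Finset.range (a.natAbs + b.natAbs + 1)).image
    fun n : ℕ => ((n : ℤ), -1 - (n : ℤ)))]
  · rw [Finset.sum_image fun _ _ _ _ h => hinj h]
    have hterm : ∀ n : ℕ, cauchyInner n (-1 - n) * f (a - n) (b - (-1 - n)) =
        K (a - n) (b + n) - K (a - (n + 1 : ℕ)) (b + (n + 1 : ℕ)) := by
      intro n
      rw [cauchyInner, if_pos (by omega), hf, neg_one_mul, neg_sub]
      congr 2 <;> (push_cast; ring)
    rw [Finset.sum_congr rfl fun n _ => hterm n,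
      Finset.sum_range_sub' fun n : ℕ => K (a - n) (b + n),
      hK (a - (a.natAbs + b.natAbs + 1 : ℕ)) _ (by omega) (by omega)]
    simp
  · rintro ⟨p, q⟩ hpq
    have h1 : 0 ≤ p ∧ q = -p - 1 := by
      by_contra h
      exact hpq (by simp [cauchyInner, h])
    have h2 : p < a.natAbs + b.natAbs + 1 := by
      by_contra h
      refine hpq ?_
      simp only
      rw [hf, hK _ _ (by omega) (by omega), hK _ _ (by omega) (by omega), sub_zero, mul_zero]
    simp only [Finset.coe_image, Set.mem_image, Finset.coe_range, Set.mem_Iio, Prod.mk.injEq]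
    exact ⟨p.toNat, by omega, by omega, by omega⟩

theorem formalPairOuter_eq_seriesMul (G : CFock → CFock) :
    formalPairOuter G = seriesMul cauchyOuter (formalTau G) := by
  refine (seriesMul_cauchyOuter (formalTau_eq_outer G) fun a b ha => ?_).symm
  rw [formalPairOuter, vev_psi_mul_psiStar, if_neg (by omega), if_neg (by omega), add_zero]

theorem formalPairInner_eq_seriesMul (G : CFock → CFock) :
    formalPairInner G = seriesMul cauchyInner (formalTau G) := by
  refine (seriesMul_cauchyInner (formalTau_eq_inner G) fun a b ha hb => ?_).symm
  rw [formalPairInner_eq, formalPairOuter, vev_psi_mul_psiStar,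
    if_neg (c := a < 0 ∧ 0 ≤ -b - 1) (by omega), add_zero]
  split_ifs <;> first | omega | simp

end Formal

end FermiFock

end

theorem mainTheorem1
    (g : ℤ → ℤ → ℂ) (hg : FermiFock.IsLowerTriangular g)
    (G : FermiFock.CFock → FermiFock.CFock) (hG : FermiFock.IsCliffordRep g G) :
    -- the identity for complex numbers `z`, `w`: both series converge for the same `z`, `w`,
    -- and there the values agree
    (∀ z w : ℂ, z ≠ 0 → w ≠ 0 → ‖z‖ ≠ ‖w‖ →
      (Summable (FermiFock.pairTerm G z w) ↔
        Summable (FermiFock.tauTerm G (FermiFock.miwa z w))) ∧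
      FermiFock.pairCorrelator G z w = FermiFock.tau G (FermiFock.miwa z w) / (z - w)) ∧
    -- the identity for formal series, in the two expansions
    FermiFock.formalPairOuter G =
      FermiFock.seriesMul FermiFock.cauchyOuter (FermiFock.formalTau G) ∧
    FermiFock.formalPairInner G =
      FermiFock.seriesMul FermiFock.cauchyInner (FermiFock.formalTau G) ∧
    -- the underlying identity of covectors, evaluated on every basis vector
    (∀ z w : ℂ, z ≠ 0 → w ≠ 0 → ‖z‖ ≠ ‖w‖ → ∀ S : FermiFock.Maya,
      HasSum (fun p : ℤ × ℤ => z ^ p.1 * w ^ (-p.2 - 1) *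
          FermiFock.matEl (FermiFock.orderedPair z w p.1 p.2) FermiFock.Maya.vac S)
        (FermiFock.matEl (FermiFock.gammaPlus (FermiFock.miwa z w)) FermiFock.Maya.vac S
          / (z - w))) := by
  refine ⟨fun z w hz hw h => ⟨FermiFock.summable_pairTerm_iff G hz hw h,
    FermiFock.pairCorrelator_eq G hz hw h⟩, FermiFock.formalPairOuter_eq_seriesMul G,
    FermiFock.formalPairInner_eq_seriesMul G,
    fun z w hz hw h S => FermiFock.hasSum_matEl_orderedPair hz hw h S⟩
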